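/- \textbf{Setting.} Let $h:\mathbb R^p\times\mathbb R^r\to\mathbb R^q$, $d\in\mathbb R^r$, $\Phi:\mathbb R^p\times\mathbb R^q\to\mathbb R$ with $p\ge 1$, and $\tilde\Phi(u)=\Phi(u,h(u,d))$. Assume that $u\mapsto h(u,d)$ and $\Phi$ are differentiable, that $\tilde\Phi$ is $M$-Lipschitz with $L$-Lipschitz gradient and $\tilde\Phi^*=\inf\tilde\Phi>-\infty$, and that $\Phi$ is $M_\Phi$-Lipschitz in $y$, where $L,M,M_\Phi>0$. Given approximate sensitivities $\hat H_k\in\mathbb R^{q\times p}$, weights $\alpha_k\in[0,1]$, $\eta,\delta>0$ and initial vectors $w_0,u_{-1}\in\mathbb R^p$, the gray-box closed loop is, for $k\ge 0$, with $y_k=h(u_k,d)$ and $y_{-1}=h(u_{-1},d)$, $$u_k=w_k+\delta v_k,\qquad w_{k+1}=w_k-\eta\Big[\alpha_k\big(\nabla_u\Phi(u_k,y_k)+\hat H_k^\top\nabla_y\Phi(u_k,y_k)\big)+(1-\alpha_k)\tfrac{p}{\delta}\big(\Phi(u_k,y_k)-\Phi(u_{k-1},y_{k-1})\big)v_k\Big],$$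 where the $v_k$ are i.i.d. uniform on the unit sphere of $\mathbb R^p$; $v_k$ and $\hat H_k$ are measurable with respect to the information available at time $k$, and $v_{k+1}$ is independent of that information. The model-based controller is the deterministic case $\alpha_k=1$, $\delta=0$. The sensitivity error is $\epsilon_{H,k}=\|\hat H_k-\nabla_uh(u_k,d)\|$ (operator norm, along the closed loop in question). Let $T\ge1$, $\Delta=\tilde\Phi(w_0)-\tilde\Phi^*$, $\kappa,\kappa'\in(0,1]$. The model-based step size is $\eta=\kappa/(4L)$; the gray-box parameters are $\eta=\kappa'/(224Lp^2T^{1/3})$ and $\delta=\sqrt2M/(112LT^{1/3})$. For a real sequence $e=(e_k)$ with $e_k\ge0$ and a number $c\ge 0$ put $$B_{\rm MB}(e,T)=\frac{16L\Delta}{\kappa T}+\frac{3M_\Phi^2}{T}\sum_{k<T}e_k^2,$$ $$B_{\rm GB}(\alpha,e,c,p,T)=\frac{896L\Delta}{\kappa'}\frac{p^2}{T^{2/3}}+\frac{5M_\Phi^2}{T}\sum_{k<T}\alpha_ke_k^2+\frac{M^2}{112^2T^{5/3}}\sum_{k<T}\big(8\alpha_k+p^2(1-\alpha_k)\big)+\frac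 cT .$$ \textbf{Claim.} (0) \emph{The bounds are valid.} If $\epsilon_{H,k}\le e_k$ for all $k<T$ (almost surely in the gray-box case), then the model-based controller satisfies $\frac1T\sum_{k<T}\|\nabla\tilde\Phi(w_k)\|^2\le B_{\rm MB}(e,T)$, and the gray-box controller, for every sequence $\alpha_k\in[0,1]$, satisfies $\frac1T\sum_{k<T}\mathbb E\|\nabla\tilde\Phi(w_k)\|^2\le B_{\rm GB}(\alpha,e,c,p,T)$, where $c=c(M,\mathbb E\|\tilde\phi_0\|^2)>0$ for a universal function $c(\cdot,\cdot)$, and $\tilde\phi_0$ is the bracket above at $k=0$. (1) \emph{Errors decaying at rate $\theta\ge\frac13$: the model-based bound is preferable.} Let $\bar\epsilon'>0$, $\theta\ge\frac13$. There are $K,K'>0$, depending only on $L,M,M_\Phi,\Delta,\bar\epsilon',\theta,\kappa,\kappa'$, such that for all $T\ge1$ and all $0\le e_k\le\bar\epsilon'/(k+1)^\theta$ ($k<T$): $B_{\rm MB}(e,T)\le K/T^{2/3}$, and for all $p\ge1$, $\alpha_k\in[0,1]$, $c\ge0$, $$\frac K{T^{2/3}}\le K'\,B_{\rm GB}(\alpha,e,c,p,T),\qquad\text{and,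 if }\Delta>0,\qquad \frac K{T^{2/3}}\le\frac{K'}{p^2}\,B_{\rm GB}(\alpha,e,c,p,T);$$ in particular $K/T^{2/3}<B_{\rm GB}(\alpha,e,c,p,T)$ if $\Delta>0$ and $p^2>K'$. (2) \emph{Bounded errors, or errors decaying at rate $\theta<\frac13$: the gray-box bound is smaller.} Let $\bar\epsilon>0$ and $0\le\theta<\frac13$, put $E_k=\bar\epsilon/(k+1)^\theta$ ($\theta=0$ is the case of merely bounded errors), let $C>0$, $R\ge0$ and $\alpha_k=\min\{C/(k+1)^{2/3-2\theta},1\}$. There is $K>0$, depending only on $L,M,M_\Phi,\Delta,\bar\epsilon,\theta,C,R,\kappa,\kappa'$, such that for all $p,T\ge1$ the gray-box controller with $\epsilon_{H,k}\le E_k$ almost surely for $k<T$ and $\|w_0-u_{-1}\|\le R$ satisfies $$\frac1T\sum_{k<T}\mathbb E\|\nabla\tilde\Phi(w_k)\|^2\le K\frac{p^2}{T^{2/3}}.$$ The largest value of $B_{\rm MB}(e,T)$ over all $0\le e_k\le E_k$ is $B_{\rm MB}(E,T)$. For every $a\in(0,1]$ there is $K'>0$ such that for every sequence $e$ with $e_k\ge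 aE_k$ for all $k$ (in particular for $e=E$): $K\frac{p^2}{T^{2/3}}\le K'\frac{p^2}{T^{2/3-2\theta}}B_{\rm MB}(e,T)$ for all $p,T\ge1$, and for every $p\ge 1$ one has $K\frac{p^2}{T^{2/3}}<B_{\rm MB}(e,T)$ for all sufficiently large $T$, and $K\frac{p^2}{T^{2/3}}\big/B_{\rm MB}(e,T)\to0$ as $T\to\infty$. -/

import Mathlib

open MeasureTheory ProbabilityTheory

noncomputable section

/-- `ℝⁿ` with the Euclidean norm. -/
abbrev Euc (n : ℕ) : Type := EuclideanSpace ℝ (Fin n)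

/-- The data of the steady-state optimization problem
`min Φ(u, y)` subject to `y = h(u, d)`: steady-state map `h`, disturbance `d`, objective `Φ`. -/
structure SteadyProblem (p q r : ℕ) where
  h : Euc p → Euc r → Euc q
  d : Euc r
  Φ : Euc p → Euc q → ℝ

namespace SteadyProblem

variable {p q r : ℕ} (P : SteadyProblem p q r)

/-- The measured output `y = h(u, d)`. -/
def output (u : Euc p) : Euc q := P.h u P.d

/-- The reduced objective `u ↦ Φ(u, h(u, d))`. -/
def obj (u : Euc p) : ℝ := P.Φ u (P.output u)

/-- The infimum of the reduced objective. -/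
def objInf : ℝ := ⨅ u, P.obj u

/-- The true input-output sensitivity `∇ᵤ h(u, d)`, as a linear map `ℝᵖ → ℝ^q`
(norms of sensitivities are operator norms). -/
def sens (u : Euc p) : Euc p →L[ℝ] Euc q := fderiv ℝ P.output u

/-- The standing assumptions: `h` is differentiable in `u`, `Φ` is differentiable,
the reduced objective is `M`-Lipschitz, `L`-smooth and bounded below,
and `Φ` is `MΦ`-Lipschitz in `y`. -/
structure Regular (L M MΦ : ℝ) : Prop where
  differentiable_output : Differentiable ℝ P.output
  differentiable_Φ : Differentiable ℝ (fun z : Euc p × Euc q => P.Φ z.1 z.2)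
  lipschitz_obj : ∀ u u', |P.obj u - P.obj u'| ≤ M * ‖u - u'‖
  smooth_obj : ∀ u u', ‖gradient P.obj u - gradient P.obj u'‖ ≤ L * ‖u - u'‖
  bddBelow_obj : BddBelow (Set.range P.obj)
  lipschitz_Φ : ∀ u y y', |P.Φ u y - P.Φ u y'| ≤ MΦ * ‖y - y'‖

/-- The inexact gradient `∇ᵤΦ(u, y) + Ĥᵀ ∇_yΦ(u, y)` at `y = h(u, d)`. -/
def modelDir (Hhat : Euc p →L[ℝ] Euc q) (u : Euc p) : Euc p :=
  gradient (fun u' => P.Φ u' (P.output u)) u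
    + (ContinuousLinearMap.adjoint Hhat) (gradient (fun y => P.Φ u y) (P.output u))

/-- The gradient estimate `(p v / δ) (Φ(u, y) - Φ(u₋, y₋))` from the current and the previous
evaluation of the objective. -/
def estimateDir (δ : ℝ) (v u uPrev : Euc p) : Euc p :=
  ((p : ℝ) / δ * (P.Φ u (P.output u) - P.Φ uPrev (P.output uPrev))) • v

/-- The convex combination `a · (inexact gradient) + (1 - a) · (gradient estimate)`. -/
def direction (Hhat : Euc p →L[ℝ] Euc q) (a δ : ℝ) (v u uPrev : Euc p) : Euc p :=
  a • P.modelDir Hhat u + (1 - a) • P.estimateDir δ v u uPrev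

/-- The closed loop: the state at time `k` is the pair `(wₖ, uₖ₋₁)`, where
`uₖ = wₖ + δ vₖ` and `wₖ₊₁ = wₖ - η · directionₖ`. The loop starts from `w₀` with a
previously applied input `u₋₁`. -/
def loop (Hhat : ℕ → Euc p →L[ℝ] Euc q) (α : ℕ → ℝ) (η δ : ℝ) (v : ℕ → Euc p)
    (w₀ uInit : Euc p) : ℕ → Euc p × Euc p
  | 0 => (w₀, uInit)
  | k + 1 =>
      let s := loop Hhat α η δ v w₀ uInit k
      let u := s.1 + δ • v k
      (s.1 - η • P.direction (Hhat k) (α k) δ (v k) u s.2, u)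

/-- The candidate solution `wₖ` of the gray-box closed loop. -/
def cand (Hhat : ℕ → Euc p →L[ℝ] Euc q) (α : ℕ → ℝ) (η δ : ℝ) (v : ℕ → Euc p)
    (w₀ uInit : Euc p) (k : ℕ) : Euc p :=
  (P.loop Hhat α η δ v w₀ uInit k).1

/-- The applied input `uₖ = wₖ + δ vₖ` of the gray-box closed loop. -/
def input (Hhat : ℕ → Euc p →L[ℝ] Euc q) (α : ℕ → ℝ) (η δ : ℝ) (v : ℕ → Euc p)
    (w₀ uInit : Euc p) (k : ℕ) : Euc p :=
  P.cand Hhat α η δ v w₀ uInit k + δ • v k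

/-- The candidate `wₖ = uₖ` of the deterministic model-based controller: the closed loop with
`αₖ = 1` and `δ = 0` (the exploration and the previous input then play no role). -/
def modelCand (Hhat : ℕ → Euc p →L[ℝ] Euc q) (η : ℝ) (w₀ : Euc p) (k : ℕ) : Euc p :=
  P.cand Hhat (fun _ => 1) η 0 (fun _ => 0) w₀ w₀ k

end SteadyProblem

/-- The uniform probability distribution on the unit sphere of `ℝᵖ` (`p ≥ 1`). -/
def uniformSphere (p : ℕ) : Measure (Euc p) :=
  (((volume : Measure (Euc p)).toSphere Set.univ)⁻¹ • (volume : Measure (Euc p)).toSphere).map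
    Subtype.val

/-- A stochastic gray-box closed loop: `ℱ` is the information available over time, the `vₖ`
are revealed along `ℱ`, uniform on the sphere and independent of the past (hence i.i.d.), the
approximate sensitivity `Ĥₖ` is a function of the information at time `k`, and its error
`‖Ĥₖ - ∇ᵤh(uₖ, d)‖` along the closed loop is at most `e k` for `k < T`. -/
structure IsGrayBoxLoop {p q r : ℕ} (P : SteadyProblem p q r) (w₀ uInit : Euc p) (T : ℕ)
    (η δ : ℝ) (α e : ℕ → ℝ) {Ω : Type*} {mΩ : MeasurableSpace Ω} (μ : Measure Ω)
    (ℱ : Filtration ℕ mΩ) (v : ℕ → Ω → Euc p) (Hhat : ℕ → Ω → Euc p →L[ℝ] Euc q) : Prop where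
  adapted : ∀ k, Measurable[ℱ k] (v k)
  law : ∀ k, μ.map (v k) = uniformSphere p
  indep : ∀ k, Indep (ℱ k) (MeasurableSpace.comap (v (k + 1)) inferInstance) μ
  sens_adapted : ∀ k, Measurable[ℱ k] (Hhat k)
  error_le : ∀ k < T, ∀ᵐ ω ∂μ,
    ‖Hhat k ω - P.sens (P.input (fun j => Hhat j ω) α η δ (fun j => v j ω) w₀ uInit k)‖ ≤ e k

/-- Step size `κ / (224 L p² T^{1/3})` of the gray-box controller, `0 < κ ≤ 1`. -/
def gbStep (κ L : ℝ) (p T : ℕ) : ℝ := κ / (224 * L * (p : ℝ) ^ 2 * (T : ℝ) ^ (1 / 3 : ℝ))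

/-- Smoothing parameter `√2 M / (112 L T^{1/3})` of the gray-box controller. -/
def gbSmoothing (L M : ℝ) (T : ℕ) : ℝ := √2 * M / (112 * L * (T : ℝ) ^ (1 / 3 : ℝ))

/-- Step size `κ / (4 L)` of the model-based controller, `0 < κ ≤ 1`. -/
def mbStep (κ L : ℝ) : ℝ := κ / (4 * L)

/-- The error bound `ε / (k+1)^θ`; for `θ = 0` it is the constant bound `ε`. -/
def errEnvelope (ε θ : ℝ) (k : ℕ) : ℝ := ε / ((k : ℝ) + 1) ^ θ

/-- The combination coefficient `min {C / (k+1)^{2/3 - 2θ}, 1}`; for `θ = 0` it is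
`min {C / (k+1)^{2/3}, 1}`. -/
def combCoeff (C θ : ℝ) (k : ℕ) : ℝ := min (C / ((k : ℝ) + 1) ^ (2 / 3 - 2 * θ)) 1

/-- The performance bound of the model-based controller: `Δ` is the initial optimality gap, `e`
the sequence of sensitivity errors. -/
def mbBound (κ L MΦ Δ : ℝ) (e : ℕ → ℝ) (T : ℕ) : ℝ :=
  16 * L * Δ / (κ * T) + 3 * MΦ ^ 2 / T * ∑ k ∈ Finset.range T, e k ^ 2

/-- The performance bound of the gray-box controller: `Δ` is the initial optimality gap, `α` the
combination coefficients, `e` the sensitivity errors, `c` the constant of the `1/T` term. -/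
def gbBound (κ L M MΦ Δ c : ℝ) (α e : ℕ → ℝ) (p T : ℕ) : ℝ :=
  896 * L * Δ / κ * ((p : ℝ) ^ 2 / (T : ℝ) ^ (2 / 3 : ℝ))
    + 5 * MΦ ^ 2 / T * ∑ k ∈ Finset.range T, α k * e k ^ 2
    + M ^ 2 / (112 ^ 2 * (T : ℝ) ^ (5 / 3 : ℝ))
        * ∑ k ∈ Finset.range T, (8 * α k + (p : ℝ) ^ 2 * (1 - α k))
    + c / T

end

/-!
The model-based bound is the standard analysis of inexact gradient descent: by the chain rule the
model direction deviates from the gradient of the reduced objective by at most `MΦ` times the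
sensitivity error, and with `η ≤ 1 / (4 L)` each step decreases the objective by
`η / 4 * ‖∇f(wₖ)‖²` up to the squared deviation (`modelBased_average_le`).

For the gray-box loop the state `(wₖ, uₖ₋₁)` is independent of the exploration direction `vₖ`. Since
`vₖ` has mean zero and covariance `1 / p` times the identity, the gradient estimate is in the mean a
descent direction up to a bias of order `p L δ` (`le_integral_inner_estimateDir`). Together with the
quadratic upper bound this gives descent in expectation up to `L η² / 2` times the second moment of
the update direction (`integral_obj_succ_le`). That second moment satisfies a contractive recursion
driven by the squared gradients, the smoothing and the sensitivity errors, because the two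
evaluations in the estimate differ by two exploration steps and one move of the candidate
(`integral_norm_dir_succ_sq_le`). Summing both inequalities, the step size is small enough for the
second moments to be absorbed (`IsGrayBoxLoop.average_le`). What is left over is `M² / T` and the
second moment `s₀` of the first direction, weighted by `1 / (p² T^{1/3})`. Hence
`Cst M s = M ^ 2 + s` is a valid universal function.

The rates follow from `∑_{k<T} (k+1)^{-2/3} ≤ 3 T^{1/3}`: it controls the squared errors of rate
`θ ≥ 1 / 3`, and also `αₖ eₖ²` for the weights `αₖ ≤ C / (k+1)^{2/3 - 2θ}` when `θ < 1 / 3`. In the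
latter case `s₀` may grow like `p² T^{2/3}`, so the weight `1 / (p² T^{1/3})` is essential there
(`IsGrayBoxLoop.initial_le`). Conversely, errors of the order of the envelope keep the model-based
bound above a multiple of `T^{-2θ}` (`le_mbBound`), and the smoothing term keeps the gray-box bound
above a multiple of `T^{-2/3}` (`le_gbBound`).
-/

/-! ### The uniform distribution on the sphere -/

theorem isProbabilityMeasure_uniformSphere {p : ℕ} (hp : 1 ≤ p) :
    IsProbabilityMeasure (uniformSphere p) := by
  have : Nontrivial (Euc p) := by
    have : Nonempty (Fin p) := ⟨⟨0, hp⟩⟩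
    infer_instance
  have h0 : (volume : Measure (Euc p)).toSphere Set.univ ≠ 0 := by
    rw [Ne, Measure.measure_univ_eq_zero]
    exact Measure.toSphere_ne_zero _
  constructor
  rw [uniformSphere, Measure.map_apply measurable_subtype_coe MeasurableSet.univ]
  simp only [Set.preimage_univ, Measure.smul_apply, smul_eq_mul]
  exact ENNReal.inv_mul_cancel h0 (measure_ne_top _ _)

theorem ae_uniformSphere_norm (p : ℕ) : ∀ᵐ v ∂(uniformSphere p), ‖v‖ = 1 := by
  rw [uniformSphere, ae_map_iff measurable_subtype_coe.aemeasurable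
    (measurableSet_eq_fun measurable_norm measurable_const)]
  exact Filter.Eventually.of_forall fun x => by simp

open scoped Pointwise in
/-- The uniform distribution on the sphere is invariant under linear isometries. -/
theorem map_uniformSphere {p : ℕ} (e : Euc p ≃ₗᵢ[ℝ] Euc p) :
    (uniformSphere p).map e = uniformSphere p := by
  ext s hs
  have hes : MeasurableSet (e ⁻¹' s) := e.continuous.measurable hs
  rw [Measure.map_apply e.continuous.measurable hs, uniformSphere,
    Measure.map_apply measurable_subtype_coe hes, Measure.map_apply measurable_subtype_coe hs]
  simp only [Measure.smul_apply]
  congr 1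
  rw [Measure.toSphere_apply' _ (measurable_subtype_coe hes),
    Measure.toSphere_apply' _ (measurable_subtype_coe hs),
    ← (e.measurePreserving).measure_preimage_emb e.toHomeomorph.measurableEmbedding
      (Set.Ioo (0 : ℝ) 1 • (Subtype.val '' (Subtype.val ⁻¹' s)))]
  congr 2
  -- both sets consist of the `r • x` with `0 < r < 1`, `‖x‖ = 1` and `e x ∈ s`
  ext y
  simp only [Set.mem_preimage, Set.mem_smul, Set.mem_image, Subtype.exists, exists_and_left,
    mem_sphere_iff_norm, sub_zero, exists_prop, exists_eq_right_right]
  constructor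
  · rintro ⟨r, hr, x, ⟨hxs, hx⟩, rfl⟩
    exact ⟨r, hr, e x, ⟨hxs, by simpa using hx⟩, by simp⟩
  · rintro ⟨r, hr, x, ⟨hxs, hx⟩, h⟩
    refine ⟨r, hr, e.symm x, ⟨by simpa using hxs, by simpa using hx⟩, ?_⟩
    apply e.injective
    simp [h]

theorem integral_uniformSphere_comp {p : ℕ} (e : Euc p ≃ₗᵢ[ℝ] Euc p) (f : Euc p → ℝ) :
    ∫ v, f (e v) ∂(uniformSphere p) = ∫ v, f v ∂(uniformSphere p) := by
  conv_rhs => rw [← map_uniformSphere e]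
  exact (e.toHomeomorph.measurableEmbedding.integral_map f).symm

theorem integral_inner_uniformSphere {p : ℕ} (g : Euc p) :
    ∫ v, inner ℝ g v ∂(uniformSphere p) = 0 := by
  have h := integral_uniformSphere_comp (LinearIsometryEquiv.neg ℝ (E := Euc p))
    (fun v => inner ℝ g v)
  simp only [LinearIsometryEquiv.coe_neg, inner_neg_right, integral_neg] at h
  linarith

/-- The covariance of the uniform distribution on the sphere is `1 / p` times the identity: by
reflections the second moment only depends on the norm, and the second moments of the coordinates
add up to `1`. -/
theorem integral_inner_sq_uniformSphere {p : ℕ} (hp : 1 ≤ p) (g : Euc p) :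
    ∫ v, (inner ℝ g v) ^ 2 ∂(uniformSphere p) = ‖g‖ ^ 2 / p := by
  have := isProbabilityMeasure_uniformSphere hp
  set b := EuclideanSpace.basisFun (Fin p) ℝ
  have hrefl : ∀ i, ∫ v, (inner ℝ g v) ^ 2 ∂(uniformSphere p)
      = ‖g‖ ^ 2 * ∫ v, (inner ℝ (b i) v) ^ 2 ∂(uniformSphere p) := by
    intro i
    have hn : ‖g‖ = ‖‖g‖ • b i‖ := by simp [norm_smul]
    set e := (ℝ ∙ (g - ‖g‖ • b i))ᗮ.reflection
    have he : e g = ‖g‖ • b i := Submodule.reflection_sub hn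
    rw [← integral_uniformSphere_comp e, ← integral_const_mul]
    congr 1
    ext v
    have h1 : inner ℝ g (e v) = inner ℝ (e g) v := by
      rw [← e.inner_map_map g (e v)]
      simp [e]
    rw [h1, he, real_inner_smul_left, mul_pow]
  have hsum : ∑ i, ∫ v, (inner ℝ (b i) v) ^ 2 ∂(uniformSphere p) = 1 := by
    rw [← integral_finsetSum]
    · have : ∀ᵐ v ∂(uniformSphere p), ∑ i, (inner ℝ (b i) v) ^ 2 = 1 := by
        filter_upwards [ae_uniformSphere_norm p] with v hv
        have := b.sum_sq_norm_inner_right v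
        simpa [hv] using this
      rw [integral_congr_ae this]
      simp
    · intro i _
      apply Integrable.mono' (integrable_const (1 : ℝ))
      · exact (Continuous.aestronglyMeasurable (by fun_prop))
      · filter_upwards [ae_uniformSphere_norm p] with v hv
        have := abs_real_inner_le_norm (b i) v
        simp only [OrthonormalBasis.norm_eq_one, hv, mul_one] at this
        rw [Real.norm_eq_abs, abs_pow]
        exact pow_le_one₀ (abs_nonneg _) this
  have : (p : ℝ) * ∫ v, (inner ℝ g v) ^ 2 ∂(uniformSphere p) = ‖g‖ ^ 2 := by
    calc _ = ∑ i : Fin p, ∫ v, (inner ℝ g v) ^ 2 ∂(uniformSphere p) := by simp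
      _ = ∑ i : Fin p, ‖g‖ ^ 2 * ∫ v, (inner ℝ (b i) v) ^ 2 ∂(uniformSphere p) :=
        Finset.sum_congr rfl fun i _ => hrefl i
      _ = ‖g‖ ^ 2 := by rw [← Finset.mul_sum, hsum, mul_one]
  have hp' : (p : ℝ) ≠ 0 := by positivity
  field_simp
  linarith

/-! ### Smooth functions -/

/-- The quadratic upper and lower bounds for a function with `L`-Lipschitz gradient. -/
theorem abs_sub_sub_inner_gradient_le {E : Type*} [NormedAddCommGroup E] [InnerProductSpace ℝ E]
    [CompleteSpace E] {f : E → ℝ} {L : ℝ} (hf : Differentiable ℝ f)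
    (hL : ∀ u u', ‖gradient f u - gradient f u'‖ ≤ L * ‖u - u'‖) (x y : E) :
    |f y - f x - inner ℝ (gradient f x) (y - x)| ≤ L / 2 * ‖y - x‖ ^ 2 := by
  have hφ : ∀ t : ℝ, HasDerivAt
      (fun t : ℝ => f (x + t • (y - x)) - t * inner ℝ (gradient f x) (y - x))
      (inner ℝ (gradient f (x + t • (y - x)) - gradient f x) (y - x)) t := by
    intro t
    have h1 : HasDerivAt (fun t : ℝ => x + t • (y - x)) (y - x) t := by
      simpa using ((hasDerivAt_id t).smul_const (y - x)).const_add x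
    have h2 := (hf (x + t • (y - x))).hasFDerivAt.comp_hasDerivAt t h1
    rw [← inner_gradient_left] at h2
    have h3 := (hasDerivAt_id t).mul_const (inner ℝ (gradient f x) (y - x))
    rw [inner_sub_left]
    exact (h2.sub h3).congr_deriv (by rw [one_mul])
  have hB : ∀ t : ℝ, HasDerivAt (fun t : ℝ => L / 2 * ‖y - x‖ ^ 2 * t ^ 2)
      (L * ‖y - x‖ ^ 2 * t) t := by
    intro t
    have := ((hasDerivAt_id t).pow 2).const_mul (L / 2 * ‖y - x‖ ^ 2)
    exact this.congr_deriv (by simp; ring)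
  have key := image_norm_le_of_norm_deriv_right_le_deriv_boundary (a := 0) (b := 1)
    (f := fun t : ℝ => f (x + t • (y - x)) - t * inner ℝ (gradient f x) (y - x) - f x)
    (f' := fun t => inner ℝ (gradient f (x + t • (y - x)) - gradient f x) (y - x))
    (B := fun t => L / 2 * ‖y - x‖ ^ 2 * t ^ 2) (B' := fun t => L * ‖y - x‖ ^ 2 * t)
    (fun t _ => ((hφ t).sub_const _).continuousAt.continuousWithinAt)
    (fun t _ => ((hφ t).sub_const _).hasDerivWithinAt)
    (by simp) hB
    (by
      intro t ht
      have h1 := hL (x + t • (y - x)) x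
      rw [add_sub_cancel_left, norm_smul, Real.norm_eq_abs, abs_of_nonneg ht.1] at h1
      calc _ ≤ ‖gradient f (x + t • (y - x)) - gradient f x‖ * ‖y - x‖ := norm_inner_le_norm _ _
        _ ≤ L * (t * ‖y - x‖) * ‖y - x‖ := by gcongr
        _ = _ := by ring)
    (x := 1) (by simp)
  simp only [one_smul, add_sub_cancel, one_mul, one_pow, mul_one, Real.norm_eq_abs] at key
  convert key using 2
  ring

theorem norm_gradient_le_of_lipschitz {E : Type*} [NormedAddCommGroup E] [InnerProductSpace ℝ E]
    [CompleteSpace E] {f : E → ℝ} {M : ℝ} (hM : 0 ≤ M)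
    (hf : ∀ u u', |f u - f u'| ≤ M * ‖u - u'‖) (x : E) : ‖gradient f x‖ ≤ M := by
  rw [← (InnerProductSpace.toDual ℝ E).norm_map, toDual_gradient]
  exact norm_fderiv_le_of_lip' ℝ hM (Filter.Eventually.of_forall fun y => hf y x)

/-! ### Deterministic estimates along the closed loop -/

namespace SteadyProblem

variable {p q r : ℕ} {P : SteadyProblem p q r} {L M MΦ : ℝ}

theorem Regular.differentiable_obj (hP : P.Regular L M MΦ) : Differentiable ℝ P.obj :=
  hP.differentiable_Φ.comp (differentiable_id.prodMk hP.differentiable_output)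

theorem Regular.norm_gradient_obj_le (hP : P.Regular L M MΦ) (hM : 0 ≤ M) (u : Euc p) :
    ‖gradient P.obj u‖ ≤ M :=
  norm_gradient_le_of_lipschitz hM hP.lipschitz_obj u

theorem Regular.continuous_gradient_obj (hP : P.Regular L M MΦ) (hL : 0 ≤ L) :
    Continuous (gradient P.obj) :=
  (LipschitzWith.of_dist_le_mul (K := ⟨L, hL⟩) fun u u' => by
    rw [dist_eq_norm, dist_eq_norm]
    exact hP.smooth_obj u u').continuous

theorem Regular.fderiv_fst (hP : P.Regular L M MΦ) (u : Euc p) (y : Euc q) :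
    fderiv ℝ (fun u' => P.Φ u' y) u
      = (fderiv ℝ (fun z : Euc p × Euc q => P.Φ z.1 z.2) (u, y)).comp
          (ContinuousLinearMap.inl ℝ (Euc p) (Euc q)) :=
  HasFDerivAt.fderiv (HasFDerivAt.comp (g := fun z : Euc p × Euc q => P.Φ z.1 z.2)
    (f := fun u' => (u', y)) u (hP.differentiable_Φ (u, y)).hasFDerivAt (hasFDerivAt_prodMk_left u y))

theorem Regular.fderiv_snd (hP : P.Regular L M MΦ) (u : Euc p) (y : Euc q) :
    fderiv ℝ (fun y' => P.Φ u y') y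
      = (fderiv ℝ (fun z : Euc p × Euc q => P.Φ z.1 z.2) (u, y)).comp
          (ContinuousLinearMap.inr ℝ (Euc p) (Euc q)) :=
  HasFDerivAt.fderiv (HasFDerivAt.comp (g := fun z : Euc p × Euc q => P.Φ z.1 z.2) y
    (hP.differentiable_Φ (u, y)).hasFDerivAt (hasFDerivAt_prodMk_right u y))

/-- The chain rule: with the exact sensitivity, the model direction is the gradient. -/
theorem Regular.modelDir_sens (hP : P.Regular L M MΦ) (u : Euc p) :
    P.modelDir (P.sens u) u = gradient P.obj u := by
  refine ext_inner_right ℝ fun x => ?_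
  have h := ((hP.differentiable_Φ (u, P.output u)).hasFDerivAt.comp u
    ((hasFDerivAt_id u).prodMk (hP.differentiable_output u).hasFDerivAt)).fderiv
  have h' : fderiv ℝ P.obj u = _ := h
  rw [inner_gradient_left, h', modelDir, inner_add_left, inner_gradient_left,
    ContinuousLinearMap.adjoint_inner_left, inner_gradient_left, hP.fderiv_fst, hP.fderiv_snd]
  simp only [ContinuousLinearMap.comp_apply, ContinuousLinearMap.inl_apply,
    ContinuousLinearMap.inr_apply, ContinuousLinearMap.prod_apply, ContinuousLinearMap.id_apply,
    ← map_add, Prod.mk_add_mk, add_zero, zero_add, sens]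

theorem Regular.norm_modelDir_sub_gradient_le (hP : P.Regular L M MΦ) (hΦ : 0 ≤ MΦ)
    (H : Euc p →L[ℝ] Euc q) (u : Euc p) :
    ‖P.modelDir H u - gradient P.obj u‖ ≤ MΦ * ‖H - P.sens u‖ := by
  have h : P.modelDir H u - gradient P.obj u
      = ContinuousLinearMap.adjoint (H - P.sens u) (gradient (P.Φ u) (P.output u)) := by
    rw [← hP.modelDir_sens, modelDir, modelDir, map_sub, sub_apply]
    abel
  rw [h]
  refine (ContinuousLinearMap.le_opNorm _ _).trans ?_
  rw [LinearIsometryEquiv.norm_map, mul_comm]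
  gcongr
  exact norm_gradient_le_of_lipschitz hΦ (hP.lipschitz_Φ u) _

theorem Regular.norm_modelDir_le (hP : P.Regular L M MΦ) (hM : 0 ≤ M) (hΦ : 0 ≤ MΦ)
    (H : Euc p →L[ℝ] Euc q) (u : Euc p) :
    ‖P.modelDir H u‖ ≤ M + MΦ * ‖H - P.sens u‖ := by
  have h1 := hP.norm_modelDir_sub_gradient_le hΦ H u
  have h2 := hP.norm_gradient_obj_le hM u
  have h3 := norm_add_le (P.modelDir H u - gradient P.obj u) (gradient P.obj u)
  rw [sub_add_cancel] at h3
  linarith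

/-- At the perturbed input `w + δ v` the model direction deviates from the gradient at `w` by the
sensitivity error and the displacement. -/
theorem Regular.norm_modelDir_perturb_sub_gradient_le (hP : P.Regular L M MΦ) (hΦ : 0 ≤ MΦ)
    {H : Euc p →L[ℝ] Euc q} {w v : Euc p} {δ e : ℝ} (hδ : 0 ≤ δ) (hv : ‖v‖ = 1)
    (he : ‖H - P.sens (w + δ • v)‖ ≤ e) :
    ‖P.modelDir H (w + δ • v) - gradient P.obj w‖ ≤ MΦ * e + L * δ := by
  have h1 := hP.norm_modelDir_sub_gradient_le hΦ H (w + δ • v)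
  have h2 := hP.smooth_obj (w + δ • v) w
  rw [add_sub_cancel_left, norm_smul, hv, Real.norm_eq_abs, abs_of_nonneg hδ, mul_one] at h2
  have h3 := norm_sub_le_norm_sub_add_norm_sub (P.modelDir H (w + δ • v))
    (gradient P.obj (w + δ • v)) (gradient P.obj w)
  have h4 : MΦ * ‖H - P.sens (w + δ • v)‖ ≤ MΦ * e := by gcongr
  linarith

theorem Regular.norm_modelDir_sq_le (hP : P.Regular L M MΦ) (hΦ : 0 ≤ MΦ)
    {H : Euc p →L[ℝ] Euc q} {w v : Euc p} {δ e : ℝ} (hδ : 0 ≤ δ) (hv : ‖v‖ = 1)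
    (he : ‖H - P.sens (w + δ • v)‖ ≤ e) :
    ‖P.modelDir H (w + δ • v)‖ ^ 2
      ≤ 3 * ‖gradient P.obj w‖ ^ 2 + 3 * (L * δ) ^ 2 + 3 * MΦ ^ 2 * e ^ 2 := by
  have h1 := hP.norm_modelDir_perturb_sub_gradient_le hΦ hδ hv he
  have h2 := norm_add_le (P.modelDir H (w + δ • v) - gradient P.obj w) (gradient P.obj w)
  rw [sub_add_cancel] at h2
  have h3 : ‖P.modelDir H (w + δ • v)‖ ≤ ‖gradient P.obj w‖ + (MΦ * e + L * δ) := by linarith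
  have h4 := pow_le_pow_left₀ (norm_nonneg _) h3 2
  nlinarith [sq_nonneg (‖gradient P.obj w‖ - MΦ * e), sq_nonneg (‖gradient P.obj w‖ - L * δ),
    sq_nonneg (MΦ * e - L * δ)]

theorem Regular.le_inner_modelDir (hP : P.Regular L M MΦ) (hΦ : 0 ≤ MΦ)
    {H : Euc p →L[ℝ] Euc q} {w v : Euc p} {δ e : ℝ} (hδ : 0 ≤ δ) (hv : ‖v‖ = 1)
    (he : ‖H - P.sens (w + δ • v)‖ ≤ e) :
    ‖gradient P.obj w‖ ^ 2 / 2 - (MΦ ^ 2 * e ^ 2 + (L * δ) ^ 2)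
      ≤ inner ℝ (gradient P.obj w) (P.modelDir H (w + δ • v)) := by
  have h1 := hP.norm_modelDir_perturb_sub_gradient_le hΦ hδ hv he
  set g := gradient P.obj w
  set m := P.modelDir H (w + δ • v)
  have h2 := pow_le_pow_left₀ (norm_nonneg _) h1 2
  have h3 := abs_le.1 (abs_real_inner_le_norm g (m - g))
  rw [inner_sub_right, real_inner_self_eq_norm_sq] at h3
  nlinarith [sq_nonneg (‖g‖ - ‖m - g‖), sq_nonneg (MΦ * e - L * δ)]

theorem Regular.abs_obj_sub_le (hP : P.Regular L M MΦ) (w v : Euc p) {δ : ℝ} (hδ : 0 ≤ δ)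
    (hv : ‖v‖ = 1) :
    |P.obj (w + δ • v) - P.obj w - δ * inner ℝ (gradient P.obj w) v| ≤ L / 2 * δ ^ 2 := by
  have h := abs_sub_sub_inner_gradient_le hP.differentiable_obj hP.smooth_obj w (w + δ • v)
  rwa [add_sub_cancel_left, norm_smul, hv, Real.norm_eq_abs, abs_of_nonneg hδ, mul_one,
    real_inner_smul_right] at h

theorem estimateDir_eq (P : SteadyProblem p q r) (δ : ℝ) (v u u' : Euc p) :
    P.estimateDir δ v u u' = ((p : ℝ) / δ * (P.obj u - P.obj u')) • v := rfl

theorem Regular.norm_estimateDir_le (hP : P.Regular L M MΦ) {δ : ℝ} (hδ : 0 < δ)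
    {v : Euc p} (hv : ‖v‖ = 1) (u u' : Euc p) :
    ‖P.estimateDir δ v u u'‖ ≤ (p : ℝ) / δ * (M * ‖u - u'‖) := by
  rw [estimateDir_eq, norm_smul, hv, mul_one, Real.norm_eq_abs, abs_mul,
    abs_of_nonneg (by positivity : (0 : ℝ) ≤ (p : ℝ) / δ)]
  gcongr
  exact hP.lipschitz_obj _ _

/-- The size of the gradient estimate. The difference of the two evaluations is split at `w` and at
`w + δ v'`: the two exploration steps are controlled by the gradient at `w`, and the move from the
previous candidate `w + η d'` by the Lipschitz constant. -/
theorem Regular.norm_estimateDir_sq_le (hP : P.Regular L M MΦ) {δ η : ℝ} (hδ : 0 < δ)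
    (hη : 0 < η) (hr : 8 * ((p : ℝ) * M * η / δ) ^ 2 ≤ 1) {w v v' d' : Euc p} (hv : ‖v‖ = 1)
    (hv' : ‖v'‖ = 1) :
    ‖P.estimateDir δ v (w + δ • v) (w + η • d' + δ • v')‖ ^ 2
      ≤ 12 * (p : ℝ) ^ 2 * ‖gradient P.obj w‖ ^ 2 + 3 * (p : ℝ) ^ 2 * (L * δ) ^ 2
        + 3 / 8 * ‖d'‖ ^ 2 := by
  set g := gradient P.obj w
  have hstep : ∀ x : Euc p, ‖x‖ = 1 →
      |P.obj (w + δ • x) - P.obj w| ≤ δ * ‖g‖ + L / 2 * δ ^ 2 := by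
    intro x hx
    have h1 := abs_le.1 (hP.abs_obj_sub_le w x hδ.le hx)
    have h2 := abs_le.1 (abs_real_inner_le_norm g x)
    rw [hx, mul_one] at h2
    rw [abs_le]
    constructor <;> nlinarith
  have h3 := abs_le.1 (hP.lipschitz_obj (w + η • d' + δ • v') (w + δ • v'))
  have h4 : ‖w + η • d' + δ • v' - (w + δ • v')‖ = η * ‖d'‖ := by
    rw [show w + η • d' + δ • v' - (w + δ • v') = η • d' by abel, norm_smul, Real.norm_eq_abs,
      abs_of_pos hη]
  rw [h4] at h3
  have h1 := abs_le.1 (hstep v hv)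
  have h2 := abs_le.1 (hstep v' hv')
  have hD : |P.obj (w + δ • v) - P.obj (w + η • d' + δ • v')|
      ≤ 2 * δ * ‖g‖ + L * δ ^ 2 + M * (η * ‖d'‖) := by
    rw [abs_le]
    constructor <;> linarith
  have hn : ‖P.estimateDir δ v (w + δ • v) (w + η • d' + δ • v')‖
      ≤ 2 * (p : ℝ) * ‖g‖ + (p : ℝ) * (L * δ) + (p : ℝ) * M * η / δ * ‖d'‖ := by
    rw [estimateDir_eq, norm_smul, hv, mul_one, Real.norm_eq_abs, abs_mul,
      abs_of_nonneg (by positivity : (0 : ℝ) ≤ (p : ℝ) / δ)]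
    calc _ ≤ (p : ℝ) / δ * (2 * δ * ‖g‖ + L * δ ^ 2 + M * (η * ‖d'‖)) := by gcongr
      _ = _ := by field_simp
  have h5 := pow_le_pow_left₀ (norm_nonneg _) hn 2
  set a := 2 * (p : ℝ) * ‖g‖
  set b := (p : ℝ) * (L * δ)
  set c := (p : ℝ) * M * η / δ * ‖d'‖ with hc
  have hc2 : c ^ 2 ≤ 1 / 8 * ‖d'‖ ^ 2 := by
    rw [hc, mul_pow]
    gcongr
    linarith
  have h6 : (a + b + c) ^ 2 ≤ 3 * a ^ 2 + 3 * b ^ 2 + 3 * c ^ 2 := by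
    nlinarith [sq_nonneg (a - b), sq_nonneg (a - c), sq_nonneg (b - c)]
  have ha2 : 3 * a ^ 2 = 12 * (p : ℝ) ^ 2 * ‖g‖ ^ 2 := by ring
  have hb2 : 3 * b ^ 2 = 3 * (p : ℝ) ^ 2 * (L * δ) ^ 2 := by ring
  linarith

theorem norm_direction_sq_le (P : SteadyProblem p q r) (H : Euc p →L[ℝ] Euc q) {a : ℝ}
    (ha0 : 0 ≤ a) (ha1 : a ≤ 1) (δ : ℝ) (v u u' : Euc p) :
    ‖P.direction H a δ v u u'‖ ^ 2
      ≤ a * ‖P.modelDir H u‖ ^ 2 + (1 - a) * ‖P.estimateDir δ v u u'‖ ^ 2 := by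
  have h := norm_add_le (a • P.modelDir H u) ((1 - a) • P.estimateDir δ v u u')
  rw [norm_smul, norm_smul, Real.norm_eq_abs, Real.norm_eq_abs, abs_of_nonneg ha0,
    abs_of_nonneg (sub_nonneg.2 ha1)] at h
  have h2 := pow_le_pow_left₀ (norm_nonneg _) h 2
  rw [direction]
  nlinarith [mul_nonneg (mul_nonneg ha0 (sub_nonneg.2 ha1))
    (sq_nonneg (‖P.modelDir H u‖ - ‖P.estimateDir δ v u u'‖))]

theorem Regular.obj_sub_smul_le (hP : P.Regular L M MΦ) (w d : Euc p) (η : ℝ) :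
    P.obj (w - η • d)
      ≤ P.obj w - η * inner ℝ (gradient P.obj w) d + L * η ^ 2 / 2 * ‖d‖ ^ 2 := by
  have h := (abs_le.1 (abs_sub_sub_inner_gradient_le hP.differentiable_obj hP.smooth_obj w
    (w - η • d))).2
  rw [show w - η • d - w = (-η) • d by rw [neg_smul]; abel, norm_smul, real_inner_smul_right,
    mul_pow, Real.norm_eq_abs, sq_abs] at h
  linarith

/-- In the mean over the exploration direction, the gradient estimate is a descent direction up to
a bias of order `p L δ`. The evaluation at the previous input `u'` drops out, because the exploration
direction has mean zero. -/
theorem Regular.le_integral_inner_estimateDir (hP : P.Regular L M MΦ) (hp : 1 ≤ p) {δ : ℝ}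
    (hδ : 0 < δ) (w u' : Euc p) :
    ‖gradient P.obj w‖ ^ 2 / 2 - (p : ℝ) ^ 2 * (L * δ) ^ 2 / 8
      ≤ ∫ v, inner ℝ (gradient P.obj w) (P.estimateDir δ v (w + δ • v) u')
          ∂(uniformSphere p) := by
  have := isProbabilityMeasure_uniformSphere hp
  set g := gradient P.obj w
  have hp0 : (0 : ℝ) < p := by exact_mod_cast hp
  have hI1 : Integrable (fun v => inner ℝ g v) (uniformSphere p) := by
    refine Integrable.of_bound (by fun_prop) ‖g‖ ?_
    filter_upwards [ae_uniformSphere_norm p] with v hv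
    simpa [hv] using norm_inner_le_norm (𝕜 := ℝ) g v
  have hI2 : Integrable (fun v => (inner ℝ g v) ^ 2) (uniformSphere p) := by
    refine Integrable.of_bound (by fun_prop) (‖g‖ ^ 2) ?_
    filter_upwards [ae_uniformSphere_norm p] with v hv
    rw [norm_pow]
    refine pow_le_pow_left₀ (norm_nonneg _) ?_ 2
    simpa [hv] using norm_inner_le_norm (𝕜 := ℝ) g v
  have hlow : ∀ᵐ v ∂(uniformSphere p),
      (p : ℝ) / δ * (P.obj w - P.obj u') * inner ℝ g v + p * (inner ℝ g v) ^ 2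
        - (p : ℝ) * (L * δ) / 2 * ‖g‖
      ≤ inner ℝ g (P.estimateDir δ v (w + δ • v) u') := by
    filter_upwards [ae_uniformSphere_norm p] with v hv
    have h1 := hP.abs_obj_sub_le w v hδ.le hv
    have h2 := abs_real_inner_le_norm g v
    rw [hv, mul_one] at h2
    set R := P.obj (w + δ • v) - P.obj w - δ * inner ℝ (gradient P.obj w) v with hR
    have h3 : |R * inner ℝ g v| ≤ L / 2 * δ ^ 2 * ‖g‖ := by
      rw [abs_mul]
      exact mul_le_mul h1 h2 (abs_nonneg _) ((abs_nonneg _).trans h1)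
    have h4 : (p : ℝ) / δ * -(L / 2 * δ ^ 2 * ‖g‖) ≤ (p : ℝ) / δ * (R * inner ℝ g v) := by
      gcongr
      exact (abs_le.1 h3).1
    have h5 : inner ℝ g (P.estimateDir δ v (w + δ • v) u')
        = (p : ℝ) / δ * (P.obj w - P.obj u') * inner ℝ g v + p * (inner ℝ g v) ^ 2
          + (p : ℝ) / δ * (R * inner ℝ g v) := by
      rw [estimateDir_eq, real_inner_smul_right, hR]
      field_simp
      ring
    have h6 : (p : ℝ) / δ * -(L / 2 * δ ^ 2 * ‖g‖) = - ((p : ℝ) * (L * δ) / 2 * ‖g‖) := by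
      field_simp
    linarith
  have hcont : Continuous fun v => inner ℝ g (P.estimateDir δ v (w + δ • v) u') := by
    have := hP.differentiable_obj.continuous
    simp only [estimateDir_eq]
    fun_prop
  have hI3 : Integrable (fun v => inner ℝ g (P.estimateDir δ v (w + δ • v) u'))
      (uniformSphere p) := by
    refine Integrable.of_bound hcont.aestronglyMeasurable
      (‖g‖ * ((p : ℝ) / δ * (M * (‖w - u'‖ + δ)))) ?_
    filter_upwards [ae_uniformSphere_norm p] with v hv
    refine (norm_inner_le_norm _ _).trans ?_
    gcongr
    refine (hP.norm_estimateDir_le hδ hv _ _).trans ?_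
    have hM : 0 ≤ M := by
      have h := (abs_nonneg _).trans (hP.lipschitz_obj v 0)
      rwa [sub_zero, hv, mul_one] at h
    gcongr
    have := norm_add_le (w - u') (δ • v)
    rw [norm_smul, hv, Real.norm_eq_abs, abs_of_pos hδ, mul_one] at this
    rwa [show w + δ • v - u' = w - u' + δ • v by abel]
  have hmono := integral_mono_ae
    (((hI1.const_mul ((p : ℝ) / δ * (P.obj w - P.obj u'))).add (hI2.const_mul (p : ℝ))).sub
      (integrable_const ((p : ℝ) * (L * δ) / 2 * ‖g‖))) hI3 hlow
  refine le_trans ?_ hmono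
  rw [integral_sub' ((hI1.const_mul _).add (hI2.const_mul _)) (integrable_const _),
    integral_add' (hI1.const_mul _) (hI2.const_mul _), integral_const_mul, integral_const_mul,
    integral_inner_uniformSphere, integral_inner_sq_uniformSphere hp]
  simp only [integral_const, probReal_univ, one_smul]
  rw [mul_div_cancel₀ _ hp0.ne']
  nlinarith [sq_nonneg (‖g‖ - (p : ℝ) * (L * δ) / 2)]

/-! ### Measurability of the closed loop -/

theorem Regular.measurable_gradient_fst (hP : P.Regular L M MΦ) :
    Measurable fun u => gradient (fun u' => P.Φ u' (P.output u)) u := by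
  have h : Measurable fun u => (fderiv ℝ (fun z : Euc p × Euc q => P.Φ z.1 z.2)
      (u, P.output u)).comp (ContinuousLinearMap.inl ℝ (Euc p) (Euc q)) :=
    ((ContinuousLinearMap.compL ℝ (Euc p) (Euc p × Euc q) ℝ).flip
      (ContinuousLinearMap.inl ℝ (Euc p) (Euc q))).continuous.measurable.comp
      ((measurable_fderiv ℝ _).comp
        (measurable_id.prodMk hP.differentiable_output.continuous.measurable))
  simp only [gradient, hP.fderiv_fst]
  exact (InnerProductSpace.toDual ℝ (Euc p)).symm.continuous.measurable.comp h

theorem Regular.measurable_gradient_snd (hP : P.Regular L M MΦ) :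
    Measurable fun u => gradient (fun y => P.Φ u y) (P.output u) := by
  have h : Measurable fun u => (fderiv ℝ (fun z : Euc p × Euc q => P.Φ z.1 z.2)
      (u, P.output u)).comp (ContinuousLinearMap.inr ℝ (Euc p) (Euc q)) :=
    ((ContinuousLinearMap.compL ℝ (Euc q) (Euc p × Euc q) ℝ).flip
      (ContinuousLinearMap.inr ℝ (Euc p) (Euc q))).continuous.measurable.comp
      ((measurable_fderiv ℝ _).comp
        (measurable_id.prodMk hP.differentiable_output.continuous.measurable))
  simp only [gradient, hP.fderiv_snd]
  exact (InnerProductSpace.toDual ℝ (Euc q)).symm.continuous.measurable.comp h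

theorem Regular.measurable_modelDir (hP : P.Regular L M MΦ) :
    Measurable fun z : (Euc p →L[ℝ] Euc q) × Euc p => P.modelDir z.1 z.2 := by
  have h : Measurable fun z : (Euc q →L[ℝ] Euc p) × Euc q => z.1 z.2 :=
    ContinuousLinearMap.measurable_apply₂
  have hadj : Measurable (ContinuousLinearMap.adjoint : (Euc p →L[ℝ] Euc q) → _) :=
    ContinuousLinearMap.adjoint.continuous.measurable
  have hsnd : Measurable fun z : (Euc p →L[ℝ] Euc q) × Euc p =>
      (ContinuousLinearMap.adjoint z.1) (gradient (fun y => P.Φ z.2 y) (P.output z.2)) :=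
    h.comp ((hadj.comp measurable_fst).prodMk (hP.measurable_gradient_snd.comp measurable_snd))
  have hfst : Measurable fun z : (Euc p →L[ℝ] Euc q) × Euc p =>
      gradient (fun u' => P.Φ u' (P.output z.2)) z.2 :=
    hP.measurable_gradient_fst.comp measurable_snd
  exact hfst.add hsnd

theorem Regular.measurable_estimateDir (hP : P.Regular L M MΦ) (δ : ℝ) :
    Measurable fun z : Euc p × Euc p × Euc p => P.estimateDir δ z.1 z.2.1 z.2.2 := by
  have := hP.differentiable_obj.continuous
  simp only [estimateDir_eq]
  fun_prop

theorem Regular.measurable_direction (hP : P.Regular L M MΦ) (a δ : ℝ) :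
    Measurable fun z : (Euc p →L[ℝ] Euc q) × Euc p × Euc p × Euc p =>
      P.direction z.1 a δ z.2.1 z.2.2.1 z.2.2.2 :=
  ((hP.measurable_modelDir.comp
      (measurable_fst.prodMk (measurable_fst.comp (measurable_snd.comp measurable_snd)))).const_smul
    a).add (((hP.measurable_estimateDir δ).comp measurable_snd).const_smul (1 - a))

end SteadyProblem

/-! ### The stochastic closed loop -/

/-- Conditioning on `X`, in the form of an inequality: if `V` is independent of `X` and the mean of
`F (x, V)` is at least `ℓ x` for every `x`, then the mean of `F (X, V)` is at least that of `ℓ X`. -/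
theorem integral_comp_le_of_indepFun {Ω β γ : Type*} {mΩ : MeasurableSpace Ω}
    {mβ : MeasurableSpace β} {mγ : MeasurableSpace γ} {μ : Measure Ω} [IsProbabilityMeasure μ]
    {X : Ω → β} {V : Ω → γ} (hX : Measurable X) (hV : Measurable V) (hXV : IndepFun X V μ)
    {ℓ : β → ℝ} {F : β × γ → ℝ} (hℓ : Measurable ℓ) (hF : Measurable F)
    (hFi : Integrable (fun ω => F (X ω, V ω)) μ) (hℓi : Integrable (fun ω => ℓ (X ω)) μ)
    (hle : ∀ x, ℓ x ≤ ∫ y, F (x, y) ∂(μ.map V)) :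
    ∫ ω, ℓ (X ω) ∂μ ≤ ∫ ω, F (X ω, V ω) ∂μ := by
  have := Measure.isProbabilityMeasure_map (μ := μ) hX.aemeasurable
  have := Measure.isProbabilityMeasure_map (μ := μ) hV.aemeasurable
  have hmap := (indepFun_iff_map_prod_eq_prod_map_map hX.aemeasurable hV.aemeasurable).1 hXV
  have hFi' : Integrable F ((μ.map X).prod (μ.map V)) := by
    rw [← hmap, integrable_map_measure hF.aestronglyMeasurable (hX.prodMk hV).aemeasurable]
    exact hFi
  have hℓi' : Integrable ℓ (μ.map X) := by
    rw [integrable_map_measure hℓ.aestronglyMeasurable hX.aemeasurable]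
    exact hℓi
  rw [← integral_map hX.aemeasurable hℓ.aestronglyMeasurable,
    ← integral_map (φ := fun ω => (X ω, V ω)) (hX.prodMk hV).aemeasurable
      hF.aestronglyMeasurable, hmap, integral_prod _ hFi']
  exact integral_mono hℓi' hFi'.integral_prod_left hle

namespace IsGrayBoxLoop

variable {p q r : ℕ} {P : SteadyProblem p q r} {L M MΦ : ℝ} {w₀ uInit : Euc p} {T : ℕ} {η δ : ℝ}
  {α e : ℕ → ℝ} {Ω : Type*} {mΩ : MeasurableSpace Ω} {μ : Measure Ω}
  {ℱ : Filtration ℕ mΩ} {v : ℕ → Ω → Euc p} {Hhat : ℕ → Ω → Euc p →L[ℝ] Euc q}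

/-- The random state `(wₖ, uₖ₋₁)` of the closed loop. -/
noncomputable def state (_ : IsGrayBoxLoop P w₀ uInit T η δ α e μ ℱ v Hhat) (k : ℕ) (ω : Ω) : Euc p × Euc p :=
  P.loop (fun j => Hhat j ω) α η δ (fun j => v j ω) w₀ uInit k

/-- The random gradient estimate in the `k`-th step of the closed loop. -/
noncomputable def estimate (h : IsGrayBoxLoop P w₀ uInit T η δ α e μ ℱ v Hhat) (k : ℕ) (ω : Ω) : Euc p :=
  P.estimateDir δ (v k ω) ((h.state k ω).1 + δ • v k ω) (h.state k ω).2

/-- The random update direction in the `k`-th step of the closed loop. -/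
noncomputable def dir (h : IsGrayBoxLoop P w₀ uInit T η δ α e μ ℱ v Hhat) (k : ℕ) (ω : Ω) : Euc p :=
  P.direction (Hhat k ω) (α k) δ (v k ω) ((h.state k ω).1 + δ • v k ω) (h.state k ω).2

theorem dir_eq_comp (h : IsGrayBoxLoop P w₀ uInit T η δ α e μ ℱ v Hhat) (k : ℕ) :
    h.dir k = (fun z : (Euc p →L[ℝ] Euc q) × Euc p × Euc p × Euc p =>
        P.direction z.1 (α k) δ z.2.1 z.2.2.1 z.2.2.2) ∘
      fun ω => (Hhat k ω, v k ω, (h.state k ω).1 + δ • v k ω, (h.state k ω).2) := by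
  funext ω
  simp only [dir, Function.comp]

theorem state_succ (h : IsGrayBoxLoop P w₀ uInit T η δ α e μ ℱ v Hhat) (k : ℕ) (ω : Ω) :
    h.state (k + 1) ω
      = ((h.state k ω).1 - η • h.dir k ω, (h.state k ω).1 + δ • v k ω) := rfl

theorem measurable_exploration (h : IsGrayBoxLoop P w₀ uInit T η δ α e μ ℱ v Hhat) (k : ℕ) :
    Measurable (v k) :=
  (h.adapted k).mono (ℱ.le k) le_rfl

theorem measurable_sensitivity (h : IsGrayBoxLoop P w₀ uInit T η δ α e μ ℱ v Hhat) (k : ℕ) :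
    Measurable (Hhat k) :=
  (h.sens_adapted k).mono (ℱ.le k) le_rfl

/-- The state `(wₖ, uₖ₋₁)` only depends on the information available before time `k`. -/
theorem measurable_state_filtration (h : IsGrayBoxLoop P w₀ uInit T η δ α e μ ℱ v Hhat)
    (hP : P.Regular L M MΦ) (k : ℕ) : ∀ j, k ≤ j + 1 → Measurable[ℱ j] (h.state k) := by
  induction k with
  | zero => exact fun j _ => measurable_const
  | succ k ih =>
    intro j hkj
    have hs := ih j (by omega)
    have hv : Measurable[ℱ j] (v k) := (h.adapted k).mono (ℱ.mono (by omega)) le_rfl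
    have hH : Measurable[ℱ j] (Hhat k) := (h.sens_adapted k).mono (ℱ.mono (by omega)) le_rfl
    have hu : Measurable[ℱ j] fun ω => (h.state k ω).1 + δ • v k ω :=
      (measurable_fst.comp hs).add (hv.const_smul δ)
    have hz : Measurable[ℱ j] fun ω =>
        (Hhat k ω, v k ω, (h.state k ω).1 + δ • v k ω, (h.state k ω).2) :=
      hH.prodMk (hv.prodMk (hu.prodMk (measurable_snd.comp hs)))
    have hd : Measurable[ℱ j] (h.dir k) := by
      rw [h.dir_eq_comp]
      exact (hP.measurable_direction (α k) δ).comp hz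
    exact ((measurable_fst.comp hs).sub (hd.const_smul η)).prodMk hu

theorem measurable_state (h : IsGrayBoxLoop P w₀ uInit T η δ α e μ ℱ v Hhat)
    (hP : P.Regular L M MΦ) (k : ℕ) : Measurable (h.state k) :=
  (h.measurable_state_filtration hP k k k.le_succ).mono (ℱ.le k) le_rfl

theorem measurable_estimate (h : IsGrayBoxLoop P w₀ uInit T η δ α e μ ℱ v Hhat)
    (hP : P.Regular L M MΦ) (k : ℕ) : Measurable (h.estimate k) := by
  have hs := h.measurable_state hP k
  have hv := h.measurable_exploration k
  exact (hP.measurable_estimateDir δ).comp (hv.prodMk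
    (((measurable_fst.comp hs).add (hv.const_smul δ)).prodMk (measurable_snd.comp hs)))

theorem measurable_dir (h : IsGrayBoxLoop P w₀ uInit T η δ α e μ ℱ v Hhat)
    (hP : P.Regular L M MΦ) (k : ℕ) : Measurable (h.dir k) := by
  have hs := h.measurable_state hP k
  have hv := h.measurable_exploration k
  have hz : Measurable fun ω =>
      (Hhat k ω, v k ω, (h.state k ω).1 + δ • v k ω, (h.state k ω).2) :=
    (h.measurable_sensitivity k).prodMk (hv.prodMk
      (((measurable_fst.comp hs).add (hv.const_smul δ)).prodMk (measurable_snd.comp hs)))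
  rw [h.dir_eq_comp]
  exact (hP.measurable_direction (α k) δ).comp hz

theorem measurable_gradient (h : IsGrayBoxLoop P w₀ uInit T η δ α e μ ℱ v Hhat)
    (hP : P.Regular L M MΦ) (hL : 0 ≤ L) (k : ℕ) :
    Measurable fun ω => gradient P.obj (h.state k ω).1 :=
  (hP.continuous_gradient_obj hL).measurable.comp (measurable_fst.comp (h.measurable_state hP k))

theorem indepFun_state [IsProbabilityMeasure μ]
    (h : IsGrayBoxLoop P w₀ uInit T η δ α e μ ℱ v Hhat) (hP : P.Regular L M MΦ) (k : ℕ) :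
    IndepFun (h.state k) (v k) μ := by
  cases k with
  | zero => exact indepFun_const_left (w₀, uInit) (v 0)
  | succ k =>
    rw [IndepFun_iff_Indep]
    exact indep_of_indep_of_le_left (h.indep k)
      (h.measurable_state_filtration hP (k + 1) k le_rfl).comap_le

theorem ae_norm_exploration (h : IsGrayBoxLoop P w₀ uInit T η δ α e μ ℱ v Hhat) (k : ℕ) :
    ∀ᵐ ω ∂μ, ‖v k ω‖ = 1 := by
  have hae := ae_uniformSphere_norm p
  rw [← h.law k] at hae
  exact ae_of_ae_map (h.measurable_exploration k).aemeasurable hae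

theorem ae_error_le (h : IsGrayBoxLoop P w₀ uInit T η δ α e μ ℱ v Hhat) {k : ℕ} (hk : k < T) :
    ∀ᵐ ω ∂μ, ‖Hhat k ω - P.sens ((h.state k ω).1 + δ • v k ω)‖ ≤ e k :=
  h.error_le k hk

theorem norm_dir_le_of_estimate (h : IsGrayBoxLoop P w₀ uInit T η δ α e μ ℱ v Hhat)
    (hP : P.Regular L M MΦ) (hM : 0 ≤ M) (hΦ : 0 ≤ MΦ) (hα : ∀ k, 0 ≤ α k ∧ α k ≤ 1) {k : ℕ}
    (hk : k < T) : ∀ᵐ ω ∂μ, ‖h.dir k ω‖ ≤ M + MΦ * e k + ‖h.estimate k ω‖ := by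
  filter_upwards [h.ae_error_le hk] with ω hω
  have h1 := hP.norm_modelDir_le hM hΦ (Hhat k ω) ((h.state k ω).1 + δ • v k ω)
  have h2 : MΦ * ‖Hhat k ω - P.sens ((h.state k ω).1 + δ • v k ω)‖ ≤ MΦ * e k := by gcongr
  refine (norm_add_le _ _).trans ?_
  rw [norm_smul, norm_smul, Real.norm_eq_abs, Real.norm_eq_abs, abs_of_nonneg (hα k).1,
    abs_of_nonneg (sub_nonneg.2 (hα k).2)]
  gcongr
  · exact (mul_le_of_le_one_left (norm_nonneg _) (hα k).2).trans (by linarith)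
  · exact mul_le_of_le_one_left (norm_nonneg _) (by linarith [(hα k).1])

theorem norm_estimate_le_of_state (h : IsGrayBoxLoop P w₀ uInit T η δ α e μ ℱ v Hhat)
    (hP : P.Regular L M MΦ) (hM : 0 ≤ M) (hδ : 0 < δ) {k : ℕ} {B : ℝ}
    (hB : ∀ᵐ ω ∂μ, ‖h.state k ω‖ ≤ B) :
    ∀ᵐ ω ∂μ, ‖h.estimate k ω‖ ≤ (p : ℝ) / δ * (M * (2 * B + δ)) := by
  filter_upwards [hB, h.ae_norm_exploration k] with ω hω hv
  refine (hP.norm_estimateDir_le hδ hv _ _).trans ?_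
  gcongr
  have h1 := (norm_fst_le (h.state k ω)).trans hω
  have h2 := (norm_snd_le (h.state k ω)).trans hω
  have h3 := norm_sub_le ((h.state k ω).1 + δ • v k ω) (h.state k ω).2
  have h4 := norm_add_le (h.state k ω).1 (δ • v k ω)
  rw [norm_smul, hv, Real.norm_eq_abs, abs_of_pos hδ, mul_one] at h4
  linarith

/-- Up to time `T`, where the sensitivity errors are bounded, the states are bounded. -/
theorem exists_norm_state_le (h : IsGrayBoxLoop P w₀ uInit T η δ α e μ ℱ v Hhat)
    (hP : P.Regular L M MΦ) (hM : 0 ≤ M) (hΦ : 0 ≤ MΦ) (hδ : 0 < δ)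
    (hα : ∀ k, 0 ≤ α k ∧ α k ≤ 1) {k : ℕ} (hk : k ≤ T) :
    ∃ B : ℝ, ∀ᵐ ω ∂μ, ‖h.state k ω‖ ≤ B := by
  induction k with
  | zero => exact ⟨‖(w₀, uInit)‖, Filter.Eventually.of_forall fun ω => le_rfl⟩
  | succ k ih =>
    obtain ⟨B, hB⟩ := ih (by omega)
    set D := M + MΦ * e k + (p : ℝ) / δ * (M * (2 * B + δ))
    refine ⟨max (B + |η| * D) (B + δ), ?_⟩
    filter_upwards [hB, h.norm_estimate_le_of_state hP hM hδ hB,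
      h.norm_dir_le_of_estimate hP hM hΦ hα hk, h.ae_norm_exploration k] with ω h1 h2 h3 h4
    have h5 := (norm_fst_le (h.state k ω)).trans h1
    rw [state_succ, Prod.norm_def]
    refine max_le_max ?_ ?_
    · refine (norm_sub_le _ _).trans ?_
      rw [norm_smul, Real.norm_eq_abs]
      gcongr
      exact h3.trans (add_le_add le_rfl h2)
    · refine (norm_add_le _ _).trans ?_
      rw [norm_smul, h4, Real.norm_eq_abs, abs_of_pos hδ, mul_one]
      gcongr

theorem exists_norm_estimate_le (h : IsGrayBoxLoop P w₀ uInit T η δ α e μ ℱ v Hhat)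
    (hP : P.Regular L M MΦ) (hM : 0 ≤ M) (hΦ : 0 ≤ MΦ) (hδ : 0 < δ)
    (hα : ∀ k, 0 ≤ α k ∧ α k ≤ 1) {k : ℕ} (hk : k < T) :
    ∃ B : ℝ, ∀ᵐ ω ∂μ, ‖h.estimate k ω‖ ≤ B := by
  obtain ⟨B, hB⟩ := h.exists_norm_state_le hP hM hΦ hδ hα hk.le
  exact ⟨_, h.norm_estimate_le_of_state hP hM hδ hB⟩

section Integrability

variable [IsProbabilityMeasure μ]

theorem integrable_obj (h : IsGrayBoxLoop P w₀ uInit T η δ α e μ ℱ v Hhat)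
    (hP : P.Regular L M MΦ) (hM : 0 ≤ M) (hΦ : 0 ≤ MΦ) (hδ : 0 < δ)
    (hα : ∀ k, 0 ≤ α k ∧ α k ≤ 1) {k : ℕ} (hk : k ≤ T) :
    Integrable (fun ω => P.obj (h.state k ω).1) μ := by
  obtain ⟨B, hB⟩ := h.exists_norm_state_le hP hM hΦ hδ hα hk
  refine Integrable.of_bound (hP.differentiable_obj.continuous.measurable.comp
    (measurable_fst.comp (h.measurable_state hP k))).aestronglyMeasurable (|P.obj 0| + M * B) ?_
  filter_upwards [hB] with ω hω
  have h1 := hP.lipschitz_obj (h.state k ω).1 0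
  have h2 := abs_add_le (P.obj (h.state k ω).1 - P.obj 0) (P.obj 0)
  have h3 : M * ‖(h.state k ω).1 - 0‖ ≤ M * B := by
    rw [sub_zero]
    gcongr
    exact (norm_fst_le _).trans hω
  rw [sub_add_cancel] at h2
  rw [Real.norm_eq_abs]
  linarith

theorem integrable_norm_gradient_sq (h : IsGrayBoxLoop P w₀ uInit T η δ α e μ ℱ v Hhat)
    (hP : P.Regular L M MΦ) (hL : 0 ≤ L) (hM : 0 ≤ M) (k : ℕ) :
    Integrable (fun ω => ‖gradient P.obj (h.state k ω).1‖ ^ 2) μ := by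
  refine Integrable.of_bound ((h.measurable_gradient hP hL k).norm.pow_const 2).aestronglyMeasurable
    (M ^ 2) (Filter.Eventually.of_forall fun ω => ?_)
  rw [norm_pow, norm_norm]
  exact pow_le_pow_left₀ (norm_nonneg _) (hP.norm_gradient_obj_le hM _) 2

theorem integrable_norm_dir_sq (h : IsGrayBoxLoop P w₀ uInit T η δ α e μ ℱ v Hhat)
    (hP : P.Regular L M MΦ) (hM : 0 ≤ M) (hΦ : 0 ≤ MΦ) (hδ : 0 < δ)
    (hα : ∀ k, 0 ≤ α k ∧ α k ≤ 1) {k : ℕ} (hk : k < T) :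
    Integrable (fun ω => ‖h.dir k ω‖ ^ 2) μ := by
  obtain ⟨B, hB⟩ := h.exists_norm_estimate_le hP hM hΦ hδ hα hk
  refine Integrable.of_bound ((h.measurable_dir hP k).norm.pow_const 2).aestronglyMeasurable
    ((M + MΦ * e k + B) ^ 2) ?_
  filter_upwards [hB, h.norm_dir_le_of_estimate hP hM hΦ hα hk] with ω h1 h2
  rw [norm_pow, norm_norm]
  exact pow_le_pow_left₀ (norm_nonneg _) (h2.trans (by gcongr)) 2

theorem integrable_inner_estimate (h : IsGrayBoxLoop P w₀ uInit T η δ α e μ ℱ v Hhat)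
    (hP : P.Regular L M MΦ) (hL : 0 ≤ L) (hM : 0 ≤ M) (hΦ : 0 ≤ MΦ) (hδ : 0 < δ)
    (hα : ∀ k, 0 ≤ α k ∧ α k ≤ 1) {k : ℕ} (hk : k < T) :
    Integrable (fun ω => inner ℝ (gradient P.obj (h.state k ω).1) (h.estimate k ω)) μ := by
  obtain ⟨B, hB⟩ := h.exists_norm_estimate_le hP hM hΦ hδ hα hk
  refine Integrable.of_bound
    ((h.measurable_gradient hP hL k).inner (h.measurable_estimate hP k)).aestronglyMeasurable
    (M * B) ?_
  filter_upwards [hB] with ω h1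
  exact (norm_inner_le_norm _ _).trans
    (mul_le_mul (hP.norm_gradient_obj_le hM _) h1 (norm_nonneg _) hM)

end Integrability

/-! ### Descent in expectation -/

section Descent

variable [IsProbabilityMeasure μ]

theorem le_integral_inner_estimate (h : IsGrayBoxLoop P w₀ uInit T η δ α e μ ℱ v Hhat)
    (hP : P.Regular L M MΦ) (hp : 1 ≤ p) (hL : 0 ≤ L) (hM : 0 ≤ M) (hΦ : 0 ≤ MΦ) (hδ : 0 < δ)
    (hα : ∀ k, 0 ≤ α k ∧ α k ≤ 1) {k : ℕ} (hk : k < T) :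
    (∫ ω, ‖gradient P.obj (h.state k ω).1‖ ^ 2 ∂μ) / 2 - (p : ℝ) ^ 2 * (L * δ) ^ 2 / 8
      ≤ ∫ ω, inner ℝ (gradient P.obj (h.state k ω).1) (h.estimate k ω) ∂μ := by
  have hg := (hP.continuous_gradient_obj hL).measurable
  have hi := (h.integrable_norm_gradient_sq hP hL hM k).div_const 2
  have hF : Measurable fun z : (Euc p × Euc p) × Euc p =>
      inner ℝ (gradient P.obj z.1.1) (P.estimateDir δ z.2 (z.1.1 + δ • z.2) z.1.2) := by
    refine (hg.comp (by fun_prop)).inner ((hP.measurable_estimateDir δ).comp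
      (f := fun z : (Euc p × Euc p) × Euc p => (z.2, z.1.1 + δ • z.2, z.1.2)) (by fun_prop))
  have key := integral_comp_le_of_indepFun (h.measurable_state hP k) (h.measurable_exploration k)
    (h.indepFun_state hP k)
    (ℓ := fun x => ‖gradient P.obj x.1‖ ^ 2 / 2 - (p : ℝ) ^ 2 * (L * δ) ^ 2 / 8)
    ((((hg.comp measurable_fst).norm.pow_const 2).div_const 2).sub_const _) hF
    (h.integrable_inner_estimate hP hL hM hΦ hδ hα hk) (hi.sub (integrable_const _))
    (fun x => by
      rw [h.law k]
      exact hP.le_integral_inner_estimateDir hp hδ x.1 x.2)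
  rw [integral_sub hi (integrable_const _), integral_div, integral_const, probReal_univ,
    one_smul] at key
  exact key

/-- One step of the closed loop decreases the mean objective, up to the bias of the update direction
and its second moment. -/
theorem integral_obj_succ_le (h : IsGrayBoxLoop P w₀ uInit T η δ α e μ ℱ v Hhat)
    (hP : P.Regular L M MΦ) (hp : 1 ≤ p) (hL : 0 ≤ L) (hM : 0 ≤ M) (hΦ : 0 ≤ MΦ) (hδ : 0 < δ)
    (hη : 0 ≤ η) (hα : ∀ k, 0 ≤ α k ∧ α k ≤ 1) {k : ℕ} (hk : k < T) :
    ∫ ω, P.obj (h.state (k + 1) ω).1 ∂μ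
      ≤ ∫ ω, P.obj (h.state k ω).1 ∂μ
        - η / 2 * ∫ ω, ‖gradient P.obj (h.state k ω).1‖ ^ 2 ∂μ
        + η * (α k * (MΦ ^ 2 * e k ^ 2 + (L * δ) ^ 2)
            + (1 - α k) * ((p : ℝ) ^ 2 * (L * δ) ^ 2 / 8))
        + L * η ^ 2 / 2 * ∫ ω, ‖h.dir k ω‖ ^ 2 ∂μ := by
  have ha0 := (hα k).1
  have ha1 := sub_nonneg.2 (hα k).2
  have hI0 := h.integrable_obj hP hM hΦ hδ hα hk.le
  have hI1 := h.integrable_obj hP hM hΦ hδ hα (k := k + 1) hk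
  have hI2 := h.integrable_norm_gradient_sq hP hL hM k
  have hI3 := h.integrable_norm_dir_sq hP hM hΦ hδ hα hk
  have hI4 := h.integrable_inner_estimate hP hL hM hΦ hδ hα hk
  have hpt : ∀ᵐ ω ∂μ, P.obj (h.state (k + 1) ω).1
      ≤ (((P.obj (h.state k ω).1 - η * α k / 2 * ‖gradient P.obj (h.state k ω).1‖ ^ 2)
        - η * (1 - α k) * inner ℝ (gradient P.obj (h.state k ω).1) (h.estimate k ω))
        + L * η ^ 2 / 2 * ‖h.dir k ω‖ ^ 2)
        + η * (α k * (MΦ ^ 2 * e k ^ 2 + (L * δ) ^ 2)) := by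
    filter_upwards [h.ae_error_le hk, h.ae_norm_exploration k] with ω hω hv
    have h1 := hP.obj_sub_smul_le (h.state k ω).1 (h.dir k ω) η
    have h2 := hP.le_inner_modelDir hΦ hδ.le hv hω
    have h3 : inner ℝ (gradient P.obj (h.state k ω).1) (h.dir k ω)
        = α k * inner ℝ (gradient P.obj (h.state k ω).1)
            (P.modelDir (Hhat k ω) ((h.state k ω).1 + δ • v k ω))
          + (1 - α k) * inner ℝ (gradient P.obj (h.state k ω).1) (h.estimate k ω) := by
      rw [dir, SteadyProblem.direction, inner_add_right, real_inner_smul_right,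
        real_inner_smul_right, estimate]
    have h4 := mul_le_mul_of_nonneg_left h2 (mul_nonneg hη ha0)
    rw [h3] at h1
    rw [state_succ]
    linarith
  have hmono := integral_mono_ae hI1 ((((hI0.sub (hI2.const_mul (η * α k / 2))).sub
    (hI4.const_mul (η * (1 - α k)))).add (hI3.const_mul (L * η ^ 2 / 2))).add
    (integrable_const (η * (α k * (MΦ ^ 2 * e k ^ 2 + (L * δ) ^ 2))))) hpt
  rw [integral_add' (((hI0.sub (hI2.const_mul _)).sub (hI4.const_mul _)).add (hI3.const_mul _))
      (integrable_const _),
    integral_add' ((hI0.sub (hI2.const_mul _)).sub (hI4.const_mul _)) (hI3.const_mul _),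
    integral_sub' (hI0.sub (hI2.const_mul _)) (hI4.const_mul _),
    integral_sub' hI0 (hI2.const_mul _), integral_const_mul, integral_const_mul,
    integral_const_mul] at hmono
  simp only [integral_const, probReal_univ, one_smul] at hmono
  have h5 := mul_le_mul_of_nonneg_left (h.le_integral_inner_estimate hP hp hL hM hΦ hδ hα hk)
    (mul_nonneg hη ha1)
  linarith

/-- The second moment of the update direction contracts along the closed loop, up to terms of the
size of the gradient, the smoothing error and the sensitivity error. -/
theorem integral_norm_dir_succ_sq_le (h : IsGrayBoxLoop P w₀ uInit T η δ α e μ ℱ v Hhat)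
    (hP : P.Regular L M MΦ) (hp : 1 ≤ p) (hL : 0 ≤ L) (hM : 0 ≤ M) (hΦ : 0 ≤ MΦ) (hδ : 0 < δ)
    (hη : 0 < η) (hr : 8 * ((p : ℝ) * M * η / δ) ^ 2 ≤ 1) (hα : ∀ k, 0 ≤ α k ∧ α k ≤ 1) {k : ℕ}
    (hk : k + 1 < T) :
    ∫ ω, ‖h.dir (k + 1) ω‖ ^ 2 ∂μ
      ≤ 3 / 8 * ∫ ω, ‖h.dir k ω‖ ^ 2 ∂μ
        + (12 * (p : ℝ) ^ 2 * ∫ ω, ‖gradient P.obj (h.state (k + 1) ω).1‖ ^ 2 ∂μ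
          + (3 * (p : ℝ) ^ 2 * (L * δ) ^ 2 + 3 * MΦ ^ 2 * (α (k + 1) * e (k + 1) ^ 2))) := by
  have ha0 := (hα (k + 1)).1
  have ha1 := (hα (k + 1)).2
  have hp1 : (1 : ℝ) ≤ (p : ℝ) ^ 2 := one_le_pow₀ (by exact_mod_cast hp)
  have hI0 := h.integrable_norm_dir_sq hP hM hΦ hδ hα (k := k) (by omega)
  have hI1 := h.integrable_norm_dir_sq hP hM hΦ hδ hα hk
  have hI2 := h.integrable_norm_gradient_sq hP hL hM (k + 1)
  have hpt : ∀ᵐ ω ∂μ, ‖h.dir (k + 1) ω‖ ^ 2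
      ≤ 3 / 8 * ‖h.dir k ω‖ ^ 2
        + (12 * (p : ℝ) ^ 2 * ‖gradient P.obj (h.state (k + 1) ω).1‖ ^ 2
          + (3 * (p : ℝ) ^ 2 * (L * δ) ^ 2 + 3 * MΦ ^ 2 * (α (k + 1) * e (k + 1) ^ 2))) := by
    filter_upwards [h.ae_error_le hk, h.ae_norm_exploration k, h.ae_norm_exploration (k + 1)]
      with ω hω hv hv'
    have h1 := hP.norm_modelDir_sq_le hΦ hδ.le hv' hω
    have h2 := hP.norm_estimateDir_sq_le hδ hη hr (w := (h.state (k + 1) ω).1)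
      (d' := h.dir k ω) hv' hv
    rw [show (h.state (k + 1) ω).1 + η • h.dir k ω + δ • v k ω = (h.state (k + 1) ω).2 by
      rw [state_succ, sub_add_cancel]] at h2
    have h3 := P.norm_direction_sq_le (Hhat (k + 1) ω) ha0 ha1 δ (v (k + 1) ω)
      ((h.state (k + 1) ω).1 + δ • v (k + 1) ω) (h.state (k + 1) ω).2
    rw [dir]
    set G := ‖gradient P.obj (h.state (k + 1) ω).1‖ ^ 2
    have hG : 0 ≤ G := sq_nonneg _
    have hLδ : 0 ≤ (L * δ) ^ 2 := sq_nonneg _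
    have h1' := mul_le_mul_of_nonneg_left h1 ha0
    have h2' := mul_le_mul_of_nonneg_left h2 (sub_nonneg.2 ha1)
    -- both bounds are at most the sum of the common terms `12 p² G` and `3 p² (L δ)²`
    have h4 : α (k + 1) * (3 * G + 3 * (L * δ) ^ 2)
        ≤ α (k + 1) * (12 * (p : ℝ) ^ 2 * G + 3 * (p : ℝ) ^ 2 * (L * δ) ^ 2) := by
      gcongr <;> nlinarith
    have h5 : (1 - α (k + 1)) * (3 / 8 * ‖h.dir k ω‖ ^ 2) ≤ 3 / 8 * ‖h.dir k ω‖ ^ 2 :=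
      mul_le_of_le_one_left (by positivity) (by linarith)
    linarith
  have hmono := integral_mono_ae hI1 ((hI0.const_mul (3 / 8)).add
    ((hI2.const_mul (12 * (p : ℝ) ^ 2)).add (integrable_const
      (3 * (p : ℝ) ^ 2 * (L * δ) ^ 2 + 3 * MΦ ^ 2 * (α (k + 1) * e (k + 1) ^ 2))))) hpt
  rw [integral_add' (hI0.const_mul _) ((hI2.const_mul _).add (integrable_const _)),
    integral_add' (hI2.const_mul _) (integrable_const _), integral_const_mul,
    integral_const_mul] at hmono
  simpa using hmono

end Descent

end IsGrayBoxLoop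

/-! ### The gray-box bound -/

theorem sum_range_le_of_contraction {s c : ℕ → ℝ} {T : ℕ} (hs : ∀ k, 0 ≤ s k) (hc : ∀ k, 0 ≤ c k)
    (hstep : ∀ k, k + 1 < T → s (k + 1) ≤ 3 / 8 * s k + c (k + 1)) :
    5 / 8 * ∑ k ∈ Finset.range T, s k ≤ s 0 + ∑ k ∈ Finset.range T, c k := by
  cases T with
  | zero => simpa using hs 0
  | succ n =>
    have h1 : ∑ k ∈ Finset.range n, s (k + 1)
        ≤ 3 / 8 * ∑ k ∈ Finset.range n, s k + ∑ k ∈ Finset.range n, c (k + 1) := by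
      rw [Finset.mul_sum, ← Finset.sum_add_distrib]
      exact Finset.sum_le_sum fun k hk => hstep k (by simpa using hk)
    have h2 : ∑ k ∈ Finset.range (n + 1), s k = _ := Finset.sum_range_succ' s n
    have h3 : ∑ k ∈ Finset.range (n + 1), s k = _ := Finset.sum_range_succ s n
    have h4 := Finset.sum_range_succ' c n
    linarith [hs n, hc 0]

theorem SteadyProblem.Regular.objInf_le {p q r : ℕ} {P : SteadyProblem p q r} {L M MΦ : ℝ}
    (hP : P.Regular L M MΦ) (u : Euc p) : P.objInf ≤ P.obj u :=
  ciInf_le hP.bddBelow_obj u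

namespace IsGrayBoxLoop

variable {p q r : ℕ} {P : SteadyProblem p q r} {L M MΦ : ℝ} {w₀ uInit : Euc p} {T : ℕ} {η δ : ℝ}
  {α e : ℕ → ℝ} {Ω : Type*} {mΩ : MeasurableSpace Ω} {μ : Measure Ω} [IsProbabilityMeasure μ]
  {ℱ : Filtration ℕ mΩ} {v : ℕ → Ω → Euc p} {Hhat : ℕ → Ω → Euc p →L[ℝ] Euc q}

theorem sum_integral_norm_gradient_sq_le (h : IsGrayBoxLoop P w₀ uInit T η δ α e μ ℱ v Hhat)
    (hP : P.Regular L M MΦ) (hp : 1 ≤ p) (hL : 0 ≤ L) (hM : 0 ≤ M) (hΦ : 0 ≤ MΦ) (hδ : 0 < δ)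
    (hη : 0 < η) (hα : ∀ k, 0 ≤ α k ∧ α k ≤ 1) :
    2 * ∑ k ∈ Finset.range T, ∫ ω, ‖gradient P.obj (h.state k ω).1‖ ^ 2 ∂μ
      ≤ 4 * (P.obj w₀ - P.objInf) / η + 4 * MΦ ^ 2 * ∑ k ∈ Finset.range T, α k * e k ^ 2
        + (L * δ) ^ 2 / 2 * ∑ k ∈ Finset.range T, (8 * α k + (p : ℝ) ^ 2 * (1 - α k))
        + 2 * L * η * ∑ k ∈ Finset.range T, ∫ ω, ‖h.dir k ω‖ ^ 2 ∂μ := by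
  have hsum : ∑ k ∈ Finset.range T, (∫ ω, P.obj (h.state (k + 1) ω).1 ∂μ
        - ∫ ω, P.obj (h.state k ω).1 ∂μ)
      ≤ ∑ k ∈ Finset.range T,
        (- (η / 2) * ∫ ω, ‖gradient P.obj (h.state k ω).1‖ ^ 2 ∂μ
          + η * MΦ ^ 2 * (α k * e k ^ 2)
          + η * (L * δ) ^ 2 / 8 * (8 * α k + (p : ℝ) ^ 2 * (1 - α k))
          + L * η ^ 2 / 2 * ∫ ω, ‖h.dir k ω‖ ^ 2 ∂μ) := by
    refine Finset.sum_le_sum fun k hk => ?_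
    have := h.integral_obj_succ_le hP hp hL hM hΦ hδ hη.le hα (Finset.mem_range.1 hk)
    linarith
  rw [Finset.sum_range_sub (fun k => ∫ ω, P.obj (h.state k ω).1 ∂μ), Finset.sum_add_distrib,
    Finset.sum_add_distrib, Finset.sum_add_distrib, ← Finset.mul_sum, ← Finset.mul_sum,
    ← Finset.mul_sum, ← Finset.mul_sum] at hsum
  have h0 : ∫ ω, P.obj (h.state 0 ω).1 ∂μ = P.obj w₀ := by
    simp [state, SteadyProblem.loop]
  have hT : P.objInf ≤ ∫ ω, P.obj (h.state T ω).1 ∂μ := by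
    have := integral_mono (integrable_const P.objInf) (h.integrable_obj hP hM hΦ hδ hα le_rfl)
      fun ω => hP.objInf_le _
    simpa using this
  rw [h0] at hsum
  set G := ∑ k ∈ Finset.range T, ∫ ω, ‖gradient P.obj (h.state k ω).1‖ ^ 2 ∂μ
  set S := ∑ k ∈ Finset.range T, ∫ ω, ‖h.dir k ω‖ ^ 2 ∂μ
  set A := ∑ k ∈ Finset.range T, (8 * α k + (p : ℝ) ^ 2 * (1 - α k))
  set E := ∑ k ∈ Finset.range T, α k * e k ^ 2
  have key : η * (2 * G) ≤ η * (4 * (P.obj w₀ - P.objInf) / η + 4 * MΦ ^ 2 * E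
      + (L * δ) ^ 2 / 2 * A + 2 * L * η * S) := by
    have : η * (4 * (P.obj w₀ - P.objInf) / η) = 4 * (P.obj w₀ - P.objInf) := by field_simp
    linarith
  exact le_of_mul_le_mul_left key hη

theorem sum_integral_norm_dir_sq_le (h : IsGrayBoxLoop P w₀ uInit T η δ α e μ ℱ v Hhat)
    (hP : P.Regular L M MΦ) (hp : 1 ≤ p) (hL : 0 ≤ L) (hM : 0 ≤ M) (hΦ : 0 ≤ MΦ) (hδ : 0 < δ)
    (hη : 0 < η) (hr : 8 * ((p : ℝ) * M * η / δ) ^ 2 ≤ 1) (hα : ∀ k, 0 ≤ α k ∧ α k ≤ 1) :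
    5 / 8 * ∑ k ∈ Finset.range T, ∫ ω, ‖h.dir k ω‖ ^ 2 ∂μ
      ≤ ∫ ω, ‖h.dir 0 ω‖ ^ 2 ∂μ
        + (12 * (p : ℝ) ^ 2 * ∑ k ∈ Finset.range T,
            ∫ ω, ‖gradient P.obj (h.state k ω).1‖ ^ 2 ∂μ
          + 3 * (p : ℝ) ^ 2 * (L * δ) ^ 2 * T
          + 3 * MΦ ^ 2 * ∑ k ∈ Finset.range T, α k * e k ^ 2) := by
  refine (sum_range_le_of_contraction (c := fun k =>
      12 * (p : ℝ) ^ 2 * ∫ ω, ‖gradient P.obj (h.state k ω).1‖ ^ 2 ∂μ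
        + (3 * (p : ℝ) ^ 2 * (L * δ) ^ 2 + 3 * MΦ ^ 2 * (α k * e k ^ 2)))
    (fun k => integral_nonneg fun ω => sq_nonneg _) (fun k => ?_) (fun k hk =>
      h.integral_norm_dir_succ_sq_le hP hp hL hM hΦ hδ hη hr hα hk)).trans_eq ?_
  · have h1 : 0 ≤ ∫ ω, ‖gradient P.obj (h.state k ω).1‖ ^ 2 ∂μ :=
      integral_nonneg fun ω => sq_nonneg _
    have h2 := mul_nonneg (hα k).1 (sq_nonneg (e k))
    positivity
  · rw [Finset.sum_add_distrib, Finset.sum_add_distrib, Finset.sum_const, Finset.card_range,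
      nsmul_eq_mul, ← Finset.mul_sum, ← Finset.mul_sum]
    ring

end IsGrayBoxLoop

theorem one_le_rpow_third {T : ℕ} (hT : 1 ≤ T) : (1 : ℝ) ≤ (T : ℝ) ^ (1 / 3 : ℝ) :=
  Real.one_le_rpow (by exact_mod_cast hT) (by norm_num)

theorem rpow_third_pow_three (T : ℕ) : ((T : ℝ) ^ (1 / 3 : ℝ)) ^ 3 = T := by
  rw [← Real.rpow_natCast, ← Real.rpow_mul (by positivity)]
  norm_num

theorem rpow_third_sq (T : ℕ) : (T : ℝ) ^ (2 / 3 : ℝ) = ((T : ℝ) ^ (1 / 3 : ℝ)) ^ 2 := by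
  rw [← Real.rpow_natCast, ← Real.rpow_mul (by positivity)]
  norm_num

theorem rpow_third_pow_five (T : ℕ) : (T : ℝ) ^ (5 / 3 : ℝ) = ((T : ℝ) ^ (1 / 3 : ℝ)) ^ 5 := by
  rw [← Real.rpow_natCast, ← Real.rpow_mul (by positivity)]
  norm_num

theorem gbStep_pos {κ L : ℝ} (hκ : 0 < κ) (hL : 0 < L) {p T : ℕ} (hp : 1 ≤ p) (hT : 1 ≤ T) :
    0 < gbStep κ L p T := by
  have hx := one_le_rpow_third hT
  have hp' : (0 : ℝ) < p := by exact_mod_cast hp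
  unfold gbStep
  positivity

theorem gbSmoothing_pos {L M : ℝ} (hL : 0 < L) (hM : 0 < M) {T : ℕ} (hT : 1 ≤ T) :
    0 < gbSmoothing L M T := by
  have hx := one_le_rpow_third hT
  unfold gbSmoothing
  positivity

/-- Step size and smoothing parameter are balanced such that the second moment of the update
direction contracts. -/
theorem gbStep_gbSmoothing_ratio {κ L M : ℝ} (hκ : 0 < κ) (hκ1 : κ ≤ 1) (hL : 0 < L) (hM : 0 < M)
    {p T : ℕ} (hp : 1 ≤ p) (hT : 1 ≤ T) :
    8 * ((p : ℝ) * M * gbStep κ L p T / gbSmoothing L M T) ^ 2 ≤ 1 := by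
  have hx := one_le_rpow_third hT
  have hp' : (1 : ℝ) ≤ p := by exact_mod_cast hp
  have h2 : (√2 : ℝ) ^ 2 = 2 := Real.sq_sqrt (by norm_num)
  have h : (p : ℝ) * M * gbStep κ L p T / gbSmoothing L M T = κ / (2 * √2 * p) := by
    unfold gbStep gbSmoothing
    have : (0 : ℝ) < √2 := by positivity
    field_simp
    norm_num
  rw [h, div_pow, mul_pow, mul_pow, h2, mul_div_assoc', div_le_one (by positivity)]
  nlinarith

/-- The second moments of the update directions, weighted by the step size, are absorbed by the
slack in the other terms of the gray-box bound. -/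
theorem mul_second_moment_le {p x κ G S E s M MΦ : ℝ} (hp : 1 ≤ p) (hx : 1 ≤ x) (hκ : 0 < κ)
    (hκ1 : κ ≤ 1) (hG : 0 ≤ G) (hE : 0 ≤ E) (hs : 0 ≤ s)
    (hS : 5 / 8 * S ≤ s + (12 * p ^ 2 * G + 3 * p ^ 2 * (2 * M ^ 2 / (112 ^ 2 * x ^ 2)) * x ^ 3
      + 3 * MΦ ^ 2 * E)) :
    κ / (112 * p ^ 2 * x) * S ≤ G + M ^ 2 + s / (p ^ 2 * x) + MΦ ^ 2 * E := by
  have hTx : (2 * M ^ 2 / (112 ^ 2 * x ^ 2)) * x ^ 3 = 2 * M ^ 2 * x / 112 ^ 2 := by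
    field_simp
  rw [mul_assoc (3 * p ^ 2), hTx] at hS
  have hc : κ / (112 * p ^ 2 * x) ≤ 1 / (112 * (p ^ 2 * x)) := by
    rw [← mul_assoc]
    gcongr
  have hpx : 1 ≤ p ^ 2 * x := one_le_mul_of_one_le_of_one_le (one_le_pow₀ hp) hx
  set R := s + (12 * p ^ 2 * G + 3 * p ^ 2 * (2 * M ^ 2 * x / 112 ^ 2) + 3 * MΦ ^ 2 * E) with hR
  have hR0 : 0 ≤ R := by positivity
  have hGx : G / x ≤ G := div_le_self hG hx
  have hE' : 0 ≤ MΦ ^ 2 * E := by positivity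
  have hEx : MΦ ^ 2 * E / (p ^ 2 * x) ≤ MΦ ^ 2 * E := div_le_self hE' hpx
  have hsx : 0 ≤ s / (p ^ 2 * x) := by positivity
  calc κ / (112 * p ^ 2 * x) * S
      ≤ κ / (112 * p ^ 2 * x) * (8 / 5 * R) := by
        gcongr
        linarith
    _ ≤ 1 / (112 * (p ^ 2 * x)) * (8 / 5 * R) := by gcongr
    _ = 8 / 560 * (s / (p ^ 2 * x)) + 96 / 560 * (G / x) + 24 / 560 * (2 * M ^ 2 / 112 ^ 2)
        + 24 / 560 * (MΦ ^ 2 * E / (p ^ 2 * x)) := by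
      rw [hR]
      field_simp
      ring
    _ ≤ _ := by linarith [sq_nonneg M]

/-- The gray-box bound, with the contribution of the first update direction still weighted by
`1 / (p² T^{1/3})`. This weight is needed for the rate `T^{-2/3}`, because the second moment of the
first direction may itself grow like `p² T^{2/3}`. -/
theorem IsGrayBoxLoop.average_le {p q r T : ℕ} {P : SteadyProblem p q r} {κ L M MΦ : ℝ}
    {w₀ uInit : Euc p} {α e : ℕ → ℝ} {Ω : Type*} {mΩ : MeasurableSpace Ω} {μ : Measure Ω}
    [IsProbabilityMeasure μ] {ℱ : Filtration ℕ mΩ} {v : ℕ → Ω → Euc p}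
    {Hhat : ℕ → Ω → Euc p →L[ℝ] Euc q}
    (h : IsGrayBoxLoop P w₀ uInit T (gbStep κ L p T) (gbSmoothing L M T) α e μ ℱ v Hhat)
    (hP : P.Regular L M MΦ) (hp : 1 ≤ p) (hT : 1 ≤ T) (hL : 0 < L) (hM : 0 < M) (hΦ : 0 < MΦ)
    (hκ : 0 < κ) (hκ1 : κ ≤ 1) (hα : ∀ k, 0 ≤ α k ∧ α k ≤ 1) :
    1 / (T : ℝ) * ∑ k ∈ Finset.range T, ∫ ω, ‖gradient P.obj (h.state k ω).1‖ ^ 2 ∂μ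
      ≤ gbBound κ L M MΦ (P.obj w₀ - P.objInf)
          (M ^ 2 + (∫ ω, ‖h.dir 0 ω‖ ^ 2 ∂μ) / ((p : ℝ) ^ 2 * (T : ℝ) ^ (1 / 3 : ℝ))) α e p T := by
  have hδ := gbSmoothing_pos hL hM hT
  have hη := gbStep_pos hκ hL hp hT
  have h1 := h.sum_integral_norm_gradient_sq_le hP hp hL.le hM.le hΦ.le hδ hη hα
  have h2 := h.sum_integral_norm_dir_sq_le hP hp hL.le hM.le hΦ.le hδ hη
    (gbStep_gbSmoothing_ratio hκ hκ1 hL hM hp hT) hα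
  have hE : 0 ≤ ∑ k ∈ Finset.range T, α k * e k ^ 2 :=
    Finset.sum_nonneg fun k _ => mul_nonneg (hα k).1 (sq_nonneg _)
  have hG : 0 ≤ ∑ k ∈ Finset.range T, ∫ ω, ‖gradient P.obj (h.state k ω).1‖ ^ 2 ∂μ :=
    Finset.sum_nonneg fun k _ => integral_nonneg fun ω => sq_nonneg _
  have hs : 0 ≤ ∫ ω, ‖h.dir 0 ω‖ ^ 2 ∂μ := integral_nonneg fun ω => sq_nonneg _
  have hx := one_le_rpow_third hT
  have hx3 := rpow_third_pow_three T
  rw [gbBound, rpow_third_sq, rpow_third_pow_five]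
  set x := (T : ℝ) ^ (1 / 3 : ℝ) with hxdef
  set G := ∑ k ∈ Finset.range T, ∫ ω, ‖gradient P.obj (h.state k ω).1‖ ^ 2 ∂μ
  set S := ∑ k ∈ Finset.range T, ∫ ω, ‖h.dir k ω‖ ^ 2 ∂μ
  set A := ∑ k ∈ Finset.range T, (8 * α k + (p : ℝ) ^ 2 * (1 - α k))
  set E := ∑ k ∈ Finset.range T, α k * e k ^ 2
  set s := ∫ ω, ‖h.dir 0 ω‖ ^ 2 ∂μ
  set Δ := P.obj w₀ - P.objInf
  have hp' : (1 : ℝ) ≤ p := by exact_mod_cast hp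
  have hℓ : (L * gbSmoothing L M T) ^ 2 = 2 * M ^ 2 / (112 ^ 2 * x ^ 2) := by
    have h2 : (√2 : ℝ) ^ 2 = 2 := Real.sq_sqrt (by norm_num)
    rw [gbSmoothing, ← hxdef]
    field_simp
    rw [h2]
  have hη4 : 4 * Δ / gbStep κ L p T = 896 * L * Δ / κ * (p : ℝ) ^ 2 * x := by
    rw [gbStep, ← hxdef]
    field_simp
    ring
  have hLη : 2 * L * gbStep κ L p T = κ / (112 * (p : ℝ) ^ 2 * x) := by
    rw [gbStep, ← hxdef]
    field_simp
    norm_num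
  rw [hη4, hℓ, hLη] at h1
  rw [hℓ] at h2
  rw [← hx3] at h2
  have h3 := mul_second_moment_le hp' hx hκ hκ1 hG hE hs h2
  have h4 : G ≤ 896 * L * Δ / κ * (p : ℝ) ^ 2 * x + 5 * MΦ ^ 2 * E
      + M ^ 2 / (112 ^ 2 * x ^ 2) * A + (M ^ 2 + s / ((p : ℝ) ^ 2 * x)) := by
    have : 2 * M ^ 2 / (112 ^ 2 * x ^ 2) / 2 = M ^ 2 / (112 ^ 2 * x ^ 2) := by ring
    rw [this] at h1
    linarith
  have hT0 : (0 : ℝ) < T := by exact_mod_cast hT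
  calc 1 / (T : ℝ) * G ≤ 1 / (T : ℝ) * (896 * L * Δ / κ * (p : ℝ) ^ 2 * x + 5 * MΦ ^ 2 * E
      + M ^ 2 / (112 ^ 2 * x ^ 2) * A + (M ^ 2 + s / ((p : ℝ) ^ 2 * x))) := by gcongr
    _ = _ := by
      rw [← hx3]
      field_simp

theorem gbBound_mono_const {κ L M MΦ Δ c c' : ℝ} (hc : c ≤ c') (α e : ℕ → ℝ) (p T : ℕ) :
    gbBound κ L M MΦ Δ c α e p T ≤ gbBound κ L M MΦ Δ c' α e p T := by
  unfold gbBound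
  gcongr

/-! ### The model-based bound -/

theorem modelCand_succ {p q r : ℕ} (P : SteadyProblem p q r) (Hhat : ℕ → Euc p →L[ℝ] Euc q)
    (η : ℝ) (w₀ : Euc p) (k : ℕ) :
    P.modelCand Hhat η w₀ (k + 1) = P.modelCand Hhat η w₀ k
      - η • P.modelDir (Hhat k) (P.modelCand Hhat η w₀ k) := by
  simp [SteadyProblem.modelCand, SteadyProblem.cand, SteadyProblem.loop, SteadyProblem.direction]

theorem SteadyProblem.Regular.obj_sub_modelDir_le {p q r : ℕ} {P : SteadyProblem p q r}
    {L M MΦ : ℝ} (hP : P.Regular L M MΦ) (hΦ : 0 ≤ MΦ) {η : ℝ} (hη : 0 ≤ η)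
    (hLη : 4 * (L * η) ≤ 1) {H : Euc p →L[ℝ] Euc q} {w : Euc p} {e : ℝ}
    (he : ‖H - P.sens w‖ ≤ e) :
    P.obj (w - η • P.modelDir H w)
      ≤ P.obj w - η / 4 * ‖gradient P.obj w‖ ^ 2 + 3 / 4 * η * MΦ ^ 2 * e ^ 2 := by
  have h1 := hP.obj_sub_smul_le w (P.modelDir H w) η
  have h2 := (hP.norm_modelDir_sub_gradient_le hΦ H w).trans (mul_le_mul_of_nonneg_left he hΦ)
  set g := gradient P.obj w
  set m := P.modelDir H w
  have h3 := pow_le_pow_left₀ (norm_nonneg _) h2 2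
  have h4 := (abs_le.1 (abs_real_inner_le_norm g (m - g))).1
  rw [inner_sub_right, real_inner_self_eq_norm_sq] at h4
  have h5 : ‖m‖ ^ 2 ≤ 2 * ‖g‖ ^ 2 + 2 * ‖m - g‖ ^ 2 := by
    have := norm_add_le (m - g) g
    rw [sub_add_cancel] at this
    nlinarith [sq_nonneg (‖g‖ - ‖m - g‖), norm_nonneg m]
  have h6 : ‖g‖ ^ 2 / 2 - ‖m - g‖ ^ 2 / 2 ≤ inner ℝ g m := by
    nlinarith [sq_nonneg (‖g‖ - ‖m - g‖)]
  have h7 : L * η ^ 2 / 2 * ‖m‖ ^ 2 ≤ η * (1 / 8) * (2 * ‖g‖ ^ 2 + 2 * ‖m - g‖ ^ 2) := by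
    have : L * η ^ 2 / 2 ≤ η * (1 / 8) := by nlinarith
    gcongr
  have h8 := mul_le_mul_of_nonneg_left h6 hη
  have h9 := mul_le_mul_of_nonneg_left h3 hη
  rw [mul_pow] at h9
  linarith

theorem modelBased_average_le {p q r T : ℕ} {P : SteadyProblem p q r} {κ L M MΦ : ℝ}
    (hP : P.Regular L M MΦ) (hT : 1 ≤ T) (hL : 0 < L) (hΦ : 0 < MΦ) (hκ : 0 < κ) (hκ1 : κ ≤ 1)
    (w₀ : Euc p) (Hhat : ℕ → Euc p →L[ℝ] Euc q) (e : ℕ → ℝ)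
    (he : ∀ k < T, ‖Hhat k - P.sens (P.modelCand Hhat (mbStep κ L) w₀ k)‖ ≤ e k) :
    1 / (T : ℝ) * ∑ k ∈ Finset.range T,
        ‖gradient P.obj (P.modelCand Hhat (mbStep κ L) w₀ k)‖ ^ 2
      ≤ mbBound κ L MΦ (P.obj w₀ - P.objInf) e T := by
  have hη : 0 < mbStep κ L := by unfold mbStep; positivity
  have hLη : 4 * (L * mbStep κ L) ≤ 1 := by
    have : 4 * (L * mbStep κ L) = κ := by
      unfold mbStep
      field_simp
    linarith
  have hη4 : 1 / mbStep κ L = 4 * L / κ := by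
    unfold mbStep
    field_simp
  set w := P.modelCand Hhat (mbStep κ L) w₀ with hw
  have hsum : ∑ k ∈ Finset.range T, (P.obj (w (k + 1)) - P.obj (w k))
      ≤ ∑ k ∈ Finset.range T, (-(mbStep κ L / 4) * ‖gradient P.obj (w k)‖ ^ 2
        + 3 / 4 * mbStep κ L * MΦ ^ 2 * e k ^ 2) := by
    refine Finset.sum_le_sum fun k hk => ?_
    have := hP.obj_sub_modelDir_le hΦ.le hη.le hLη (he k (Finset.mem_range.1 hk))
    rw [hw, modelCand_succ, ← hw]
    linarith
  rw [Finset.sum_range_sub (fun k => P.obj (w k)), Finset.sum_add_distrib, ← Finset.mul_sum,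
    ← Finset.mul_sum] at hsum
  have h0 : w 0 = w₀ := rfl
  have hT' := hP.objInf_le (w T)
  rw [h0] at hsum
  set G := ∑ k ∈ Finset.range T, ‖gradient P.obj (w k)‖ ^ 2
  set E := ∑ k ∈ Finset.range T, e k ^ 2
  have hT0 : (0 : ℝ) < T := by exact_mod_cast hT
  have key : G ≤ 4 * (P.obj w₀ - P.objInf) * (1 / mbStep κ L) + 3 * MΦ ^ 2 * E := by
    refine le_of_mul_le_mul_left ?_ hη
    have : mbStep κ L * (4 * (P.obj w₀ - P.objInf) * (1 / mbStep κ L) + 3 * MΦ ^ 2 * E)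
        = 4 * (P.obj w₀ - P.objInf) + mbStep κ L * (3 * MΦ ^ 2 * E) := by
      field_simp
    rw [this]
    linarith
  rw [hη4] at key
  calc 1 / (T : ℝ) * G
      ≤ 1 / (T : ℝ) * (4 * (P.obj w₀ - P.objInf) * (4 * L / κ) + 3 * MΦ ^ 2 * E) := by gcongr
    _ = _ := by
      unfold mbBound
      field_simp
      ring

/-! ### Rates -/

/-- Comparison of `∑ (k+1)^{-2/3}` with the corresponding integral. -/
theorem sum_one_div_rpow_le (T : ℕ) :
    ∑ k ∈ Finset.range T, 1 / ((k : ℝ) + 1) ^ (2 / 3 : ℝ) ≤ 3 * (T : ℝ) ^ (1 / 3 : ℝ) := by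
  induction T with
  | zero => simp
  | succ n ih =>
    rw [Finset.sum_range_succ]
    have h1 := rpow_third_pow_three (n + 1)
    have h2 := rpow_third_pow_three n
    have h3 := rpow_third_sq (n + 1)
    have h4 : (n : ℝ) ^ (1 / 3 : ℝ) ≤ ((n + 1 : ℕ) : ℝ) ^ (1 / 3 : ℝ) :=
      Real.rpow_le_rpow (by positivity) (by push_cast; linarith) (by norm_num)
    have h5 : (0 : ℝ) ≤ (n : ℝ) ^ (1 / 3 : ℝ) := by positivity
    have h6 := one_le_rpow_third (T := n + 1) (by omega)
    push_cast at h1 h3 h4 h6 ⊢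
    rw [h3]
    set a := ((n : ℝ) + 1) ^ (1 / 3 : ℝ)
    set b := (n : ℝ) ^ (1 / 3 : ℝ)
    have h7 : 1 / a ^ 2 ≤ 3 * (a - b) := by
      rw [div_le_iff₀ (by positivity)]
      -- `a ^ 3 - b ^ 3 = 1`
      nlinarith [mul_nonneg (sub_nonneg.2 h4) (sub_nonneg.2 h4),
        mul_nonneg (mul_nonneg (sub_nonneg.2 h4) (sub_nonneg.2 h4)) (by linarith : 0 ≤ a + a + b)]
    linarith

theorem errEnvelope_pos {ε : ℝ} (hε : 0 < ε) (θ : ℝ) (k : ℕ) : 0 < errEnvelope ε θ k := by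
  unfold errEnvelope
  positivity

theorem errEnvelope_sq (ε θ : ℝ) (k : ℕ) :
    errEnvelope ε θ k ^ 2 = ε ^ 2 / ((k : ℝ) + 1) ^ (2 * θ) := by
  rw [errEnvelope, div_pow, ← Real.rpow_natCast (((k : ℝ) + 1) ^ θ), ← Real.rpow_mul (by positivity),
    mul_comm θ]
  norm_num

theorem combCoeff_mem {C : ℝ} (hC : 0 < C) (θ : ℝ) (k : ℕ) :
    0 ≤ combCoeff C θ k ∧ combCoeff C θ k ≤ 1 := by
  unfold combCoeff
  exact ⟨le_min (by positivity) zero_le_one, min_le_right _ _⟩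

theorem sum_errEnvelope_sq_le {ε θ : ℝ} (hθ : 1 / 3 ≤ θ) {T : ℕ} {e : ℕ → ℝ}
    (he : ∀ k < T, 0 ≤ e k ∧ e k ≤ errEnvelope ε θ k) :
    ∑ k ∈ Finset.range T, e k ^ 2 ≤ 3 * ε ^ 2 * (T : ℝ) ^ (1 / 3 : ℝ) := by
  calc ∑ k ∈ Finset.range T, e k ^ 2
      ≤ ∑ k ∈ Finset.range T, ε ^ 2 * (1 / ((k : ℝ) + 1) ^ (2 / 3 : ℝ)) := by
        refine Finset.sum_le_sum fun k hk => ?_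
        obtain ⟨h0, h1⟩ := he k (Finset.mem_range.1 hk)
        refine (pow_le_pow_left₀ h0 h1 2).trans ?_
        rw [errEnvelope_sq, mul_one_div]
        gcongr
        · linarith [Nat.cast_nonneg (α := ℝ) k]
        · linarith
    _ ≤ ε ^ 2 * (3 * (T : ℝ) ^ (1 / 3 : ℝ)) := by
        rw [← Finset.mul_sum]
        gcongr
        exact sum_one_div_rpow_le T
    _ = _ := by ring

theorem sum_combCoeff_mul_errEnvelope_sq_le (C ε θ : ℝ) (hC : 0 < C) (T : ℕ) :
    ∑ k ∈ Finset.range T, combCoeff C θ k * errEnvelope ε θ k ^ 2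
      ≤ 3 * C * ε ^ 2 * (T : ℝ) ^ (1 / 3 : ℝ) := by
  calc ∑ k ∈ Finset.range T, combCoeff C θ k * errEnvelope ε θ k ^ 2
      ≤ ∑ k ∈ Finset.range T, C * ε ^ 2 * (1 / ((k : ℝ) + 1) ^ (2 / 3 : ℝ)) := by
        refine Finset.sum_le_sum fun k _ => ?_
        have hk : (0 : ℝ) < (k : ℝ) + 1 := by positivity
        calc combCoeff C θ k * errEnvelope ε θ k ^ 2
            ≤ C / ((k : ℝ) + 1) ^ (2 / 3 - 2 * θ) * errEnvelope ε θ k ^ 2 := by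
              gcongr
              exact min_le_left _ _
          _ = C * ε ^ 2 * (1 / (((k : ℝ) + 1) ^ (2 / 3 - 2 * θ) * ((k : ℝ) + 1) ^ (2 * θ))) := by
              rw [errEnvelope_sq]
              field_simp
          _ = _ := by rw [← Real.rpow_add hk, sub_add_cancel]
    _ ≤ C * ε ^ 2 * (3 * (T : ℝ) ^ (1 / 3 : ℝ)) := by
        rw [← Finset.mul_sum]
        gcongr
        exact sum_one_div_rpow_le T
    _ = _ := by ring

/-- For errors of rate at least `1/3` the model-based bound is of order `T^{-2/3}`. -/
theorem mbBound_le_of_fast_decay {κ L MΦ Δ ε θ : ℝ} (hκ : 0 < κ) (hL : 0 < L) (hΔ : 0 ≤ Δ)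
    (hθ : 1 / 3 ≤ θ) {T : ℕ} (hT : 1 ≤ T) {e : ℕ → ℝ}
    (he : ∀ k < T, 0 ≤ e k ∧ e k ≤ errEnvelope ε θ k) :
    mbBound κ L MΦ Δ e T
      ≤ (16 * L * Δ / κ + 9 * MΦ ^ 2 * ε ^ 2) / (T : ℝ) ^ (2 / 3 : ℝ) := by
  have hsum := sum_errEnvelope_sq_le hθ he
  have hx := one_le_rpow_third hT
  have hx3 := rpow_third_pow_three T
  rw [mbBound, rpow_third_sq]
  set x := (T : ℝ) ^ (1 / 3 : ℝ)
  rw [← hx3]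
  have hx0 : 0 < x := by linarith
  calc 16 * L * Δ / (κ * x ^ 3) + 3 * MΦ ^ 2 / x ^ 3 * ∑ k ∈ Finset.range T, e k ^ 2
      ≤ 16 * L * Δ / (κ * x ^ 2) + 3 * MΦ ^ 2 / x ^ 3 * (3 * ε ^ 2 * x) := by
        gcongr 16 * L * Δ / (κ * ?_) + 3 * MΦ ^ 2 / x ^ 3 * ?_
        exact pow_le_pow_right₀ hx (by norm_num)
    _ = _ := by
        field_simp
        ring

/-- The gray-box bound cannot decay faster than `T^{-2/3}`, whatever the weights and the errors. -/
theorem le_gbBound {κ L M MΦ Δ c : ℝ} {α e : ℕ → ℝ} {p T : ℕ} (hp : 1 ≤ p) (hT : 1 ≤ T)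
    (hα : ∀ k, 0 ≤ α k ∧ α k ≤ 1) (hc : 0 ≤ c) :
    (896 * L * Δ / κ * (p : ℝ) ^ 2 + M ^ 2 / 112 ^ 2) / (T : ℝ) ^ (2 / 3 : ℝ)
      ≤ gbBound κ L M MΦ Δ c α e p T := by
  have hp2 : (1 : ℝ) ≤ (p : ℝ) ^ 2 := one_le_pow₀ (by exact_mod_cast hp)
  have hE : 0 ≤ ∑ k ∈ Finset.range T, α k * e k ^ 2 :=
    Finset.sum_nonneg fun k _ => mul_nonneg (hα k).1 (sq_nonneg _)
  have hA : (T : ℝ) ≤ ∑ k ∈ Finset.range T, (8 * α k + (p : ℝ) ^ 2 * (1 - α k)) := by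
    calc (T : ℝ) = ∑ k ∈ Finset.range T, (1 : ℝ) := by simp
      _ ≤ _ := Finset.sum_le_sum fun k _ => by nlinarith [(hα k).1, (hα k).2]
  have hx := one_le_rpow_third hT
  have hx3 := rpow_third_pow_three T
  rw [gbBound, rpow_third_sq, rpow_third_pow_five]
  set x := (T : ℝ) ^ (1 / 3 : ℝ)
  have h1 : M ^ 2 / 112 ^ 2 / x ^ 2 ≤ M ^ 2 / (112 ^ 2 * x ^ 5)
      * ∑ k ∈ Finset.range T, (8 * α k + (p : ℝ) ^ 2 * (1 - α k)) := by
    calc M ^ 2 / 112 ^ 2 / x ^ 2 = M ^ 2 / (112 ^ 2 * x ^ 5) * T := by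
          rw [← hx3]
          field_simp
      _ ≤ _ := by gcongr
  have h2 : 0 ≤ 5 * MΦ ^ 2 / T * ∑ k ∈ Finset.range T, α k * e k ^ 2 := by positivity
  have h3 : 0 ≤ c / T := by positivity
  rw [add_div, mul_div_assoc]
  linarith

theorem gbBound_le_of_slow_decay {κ L M MΦ Δ ε θ C c : ℝ} (hC : 0 < C) {p T : ℕ}
    (hp : 1 ≤ p) (hT : 1 ≤ T) {K : ℝ} (hc0 : 0 ≤ K) (hc : c ≤ K * (T : ℝ) ^ (1 / 3 : ℝ)) :
    gbBound κ L M MΦ Δ c (combCoeff C θ) (errEnvelope ε θ) p T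
      ≤ (896 * L * Δ / κ + 15 * MΦ ^ 2 * C * ε ^ 2 + 8 * M ^ 2 / 112 ^ 2 + K)
        * ((p : ℝ) ^ 2 / (T : ℝ) ^ (2 / 3 : ℝ)) := by
  have hp2 : (1 : ℝ) ≤ (p : ℝ) ^ 2 := one_le_pow₀ (by exact_mod_cast hp)
  have hα := combCoeff_mem hC θ
  have hE := sum_combCoeff_mul_errEnvelope_sq_le C ε θ hC T
  have hA : ∑ k ∈ Finset.range T, (8 * combCoeff C θ k + (p : ℝ) ^ 2 * (1 - combCoeff C θ k))
      ≤ 8 * (p : ℝ) ^ 2 * T := by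
    calc _ ≤ ∑ k ∈ Finset.range T, 8 * (p : ℝ) ^ 2 :=
          Finset.sum_le_sum fun k _ => by nlinarith [(hα k).1, (hα k).2]
      _ = _ := by
          rw [Finset.sum_const, Finset.card_range, nsmul_eq_mul]
          ring
  have hx := one_le_rpow_third hT
  have hx3 := rpow_third_pow_three T
  rw [gbBound, rpow_third_sq, rpow_third_pow_five]
  set x := (T : ℝ) ^ (1 / 3 : ℝ)
  rw [← hx3] at hA ⊢
  have hx0 : 0 < x := by linarith
  set E := ∑ k ∈ Finset.range T, combCoeff C θ k * errEnvelope ε θ k ^ 2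
  set A := ∑ k ∈ Finset.range T, (8 * combCoeff C θ k + (p : ℝ) ^ 2 * (1 - combCoeff C θ k))
  have h1 : 5 * MΦ ^ 2 / x ^ 3 * E ≤ 15 * MΦ ^ 2 * C * ε ^ 2 * ((p : ℝ) ^ 2 / x ^ 2) := by
    calc 5 * MΦ ^ 2 / x ^ 3 * E ≤ 5 * MΦ ^ 2 / x ^ 3 * (3 * C * ε ^ 2 * x) := by gcongr
      _ = 15 * MΦ ^ 2 * C * ε ^ 2 * (1 / x ^ 2) := by
        field_simp
        ring
      _ ≤ _ := by gcongr
  have h2 : M ^ 2 / (112 ^ 2 * x ^ 5) * A ≤ 8 * M ^ 2 / 112 ^ 2 * ((p : ℝ) ^ 2 / x ^ 2) := by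
    calc M ^ 2 / (112 ^ 2 * x ^ 5) * A
        ≤ M ^ 2 / (112 ^ 2 * x ^ 5) * (8 * (p : ℝ) ^ 2 * x ^ 3) := by gcongr
      _ = _ := by field_simp
  have h3 : c / x ^ 3 ≤ K * ((p : ℝ) ^ 2 / x ^ 2) := by
    calc c / x ^ 3 ≤ K * x / x ^ 3 := by gcongr
      _ = K * (1 / x ^ 2) := by field_simp
      _ ≤ _ := by gcongr
  linarith

/-- The second moment of the first update direction, in the weight with which it enters the
gray-box bound. -/
theorem IsGrayBoxLoop.initial_le {p q r T : ℕ} {P : SteadyProblem p q r} {κ L M MΦ R : ℝ}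
    {w₀ uInit : Euc p} {α e : ℕ → ℝ} {Ω : Type*} {mΩ : MeasurableSpace Ω} {μ : Measure Ω}
    [IsProbabilityMeasure μ] {ℱ : Filtration ℕ mΩ} {v : ℕ → Ω → Euc p}
    {Hhat : ℕ → Ω → Euc p →L[ℝ] Euc q}
    (h : IsGrayBoxLoop P w₀ uInit T (gbStep κ L p T) (gbSmoothing L M T) α e μ ℱ v Hhat)
    (hP : P.Regular L M MΦ) (hp : 1 ≤ p) (hT : 1 ≤ T) (hL : 0 < L) (hM : 0 < M) (hΦ : 0 < MΦ)
    (hα : ∀ k, 0 ≤ α k ∧ α k ≤ 1) (hR : ‖w₀ - uInit‖ ≤ R) :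
    M ^ 2 + (∫ ω, ‖h.dir 0 ω‖ ^ 2 ∂μ) / ((p : ℝ) ^ 2 * (T : ℝ) ^ (1 / 3 : ℝ))
      ≤ (3 * M ^ 2 + (M + MΦ * e 0) ^ 2 + (112 * L * R) ^ 2) * (T : ℝ) ^ (1 / 3 : ℝ) := by
  have hδ := gbSmoothing_pos hL hM hT
  have hI := h.integrable_norm_dir_sq hP hM.le hΦ.le hδ hα (k := 0) hT
  set δ := gbSmoothing L M T with hδdef
  have hbound : ∀ᵐ ω ∂μ, ‖h.dir 0 ω‖ ^ 2
      ≤ (M + MΦ * e 0) ^ 2 + ((p : ℝ) / δ * (M * (R + δ))) ^ 2 := by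
    filter_upwards [h.ae_error_le (k := 0) hT, h.ae_norm_exploration 0] with ω hω hv
    have h1 := P.norm_direction_sq_le (Hhat 0 ω) (hα 0).1 (hα 0).2 δ (v 0 ω)
      ((h.state 0 ω).1 + δ • v 0 ω) (h.state 0 ω).2
    have h2 := hP.norm_modelDir_le hM.le hΦ.le (Hhat 0 ω) ((h.state 0 ω).1 + δ • v 0 ω)
    have h3 : ‖P.modelDir (Hhat 0 ω) ((h.state 0 ω).1 + δ • v 0 ω)‖ ≤ M + MΦ * e 0 :=
      h2.trans (by gcongr)
    have h4 : ‖P.estimateDir δ (v 0 ω) ((h.state 0 ω).1 + δ • v 0 ω) (h.state 0 ω).2‖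
        ≤ (p : ℝ) / δ * (M * (R + δ)) := by
      refine (hP.norm_estimateDir_le hδ hv _ _).trans ?_
      gcongr
      have h5 := norm_add_le (w₀ - uInit) (δ • v 0 ω)
      rw [norm_smul, hv, Real.norm_eq_abs, abs_of_pos hδ, mul_one] at h5
      have h6 : (h.state 0 ω).1 + δ • v 0 ω - (h.state 0 ω).2 = w₀ - uInit + δ • v 0 ω := by
        change w₀ + δ • v 0 ω - uInit = _
        abel
      rw [h6]
      linarith
    refine h1.trans (add_le_add ?_ ?_)
    · exact (mul_le_of_le_one_left (sq_nonneg _) (hα 0).2).trans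
        (pow_le_pow_left₀ (norm_nonneg _) h3 2)
    · exact (mul_le_of_le_one_left (sq_nonneg _) (by linarith [(hα 0).1])).trans
        (pow_le_pow_left₀ (norm_nonneg _) h4 2)
  have hs : ∫ ω, ‖h.dir 0 ω‖ ^ 2 ∂μ
      ≤ (M + MΦ * e 0) ^ 2 + ((p : ℝ) / δ * (M * (R + δ))) ^ 2 := by
    simpa using integral_mono_ae hI (integrable_const _) hbound
  have hx := one_le_rpow_third hT
  have hp1 : (1 : ℝ) ≤ p := by exact_mod_cast hp
  have hδR : (p : ℝ) / δ * (M * (R + δ))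
      = p * (M + 112 * L * R * (T : ℝ) ^ (1 / 3 : ℝ) / √2) := by
    have : (0 : ℝ) < √2 := by positivity
    rw [hδdef, gbSmoothing]
    field_simp
    ring
  rw [hδR] at hs
  generalize (T : ℝ) ^ (1 / 3 : ℝ) = x at hs hx ⊢
  generalize (∫ ω, ‖h.dir 0 ω‖ ^ 2 ∂μ) = s at hs ⊢
  set A := (M + MΦ * e 0) ^ 2 with hA
  have hA0 : 0 ≤ A := sq_nonneg _
  have h2 : (112 * L * R * x / √2) ^ 2 = (112 * L * R) ^ 2 * x ^ 2 / 2 := by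
    rw [div_pow, Real.sq_sqrt (by norm_num)]
    ring
  have h7 : (M + 112 * L * R * x / √2) ^ 2 ≤ 2 * M ^ 2 + (112 * L * R) ^ 2 * x ^ 2 := by
    nlinarith [sq_nonneg (M - 112 * L * R * x / √2)]
  have hx2 : x ≤ x ^ 2 := by nlinarith
  have h8 : s / ((p : ℝ) ^ 2 * x) ≤ (A + 2 * M ^ 2 + (112 * L * R) ^ 2) * x := by
    rw [div_le_iff₀ (by positivity)]
    have h9 : A ≤ A * ((p : ℝ) ^ 2 * x ^ 2) :=
      le_mul_of_one_le_right hA0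
        (one_le_mul_of_one_le_of_one_le (one_le_pow₀ hp1) (one_le_pow₀ hx))
    have h10 : (p : ℝ) ^ 2 * (2 * M ^ 2) ≤ (p : ℝ) ^ 2 * (2 * M ^ 2 * x ^ 2) := by
      refine mul_le_mul_of_nonneg_left ?_ (by positivity)
      exact le_mul_of_one_le_right (by positivity) (one_le_pow₀ hx)
    have h11 : (p : ℝ) ^ 2 * (M + 112 * L * R * x / √2) ^ 2
        ≤ (p : ℝ) ^ 2 * (2 * M ^ 2 + (112 * L * R) ^ 2 * x ^ 2) := by gcongr
    rw [mul_pow] at hs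
    linarith
  have h12 : M ^ 2 ≤ M ^ 2 * x := le_mul_of_one_le_right (sq_nonneg _) hx
  linarith

theorem mbBound_le_mbBound (κ L MΦ Δ : ℝ) {e e' : ℕ → ℝ} {T : ℕ}
    (h : ∀ k < T, 0 ≤ e k ∧ e k ≤ e' k) : mbBound κ L MΦ Δ e T ≤ mbBound κ L MΦ Δ e' T := by
  unfold mbBound
  gcongr with k hk
  · exact (h k (Finset.mem_range.1 hk)).1
  · exact (h k (Finset.mem_range.1 hk)).2

/-- Errors of the order of the envelope keep the model-based bound above the order `T^{-2θ}`. -/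
theorem le_mbBound {κ L MΦ Δ ε θ a : ℝ} (hκ : 0 < κ) (hL : 0 < L) (hΔ : 0 ≤ Δ) (hε : 0 < ε)
    (hθ : 0 ≤ θ) (ha : 0 < a) {e : ℕ → ℝ} (he : ∀ k, a * errEnvelope ε θ k ≤ e k) {T : ℕ}
    (hT : 1 ≤ T) :
    3 * MΦ ^ 2 * (a * ε) ^ 2 / (T : ℝ) ^ (2 * θ) ≤ mbBound κ L MΦ Δ e T := by
  have hT0 : (0 : ℝ) < T := by exact_mod_cast hT
  have hsum : (T : ℝ) * ((a * ε) ^ 2 / (T : ℝ) ^ (2 * θ)) ≤ ∑ k ∈ Finset.range T, e k ^ 2 := by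
    calc (T : ℝ) * ((a * ε) ^ 2 / (T : ℝ) ^ (2 * θ))
        = ∑ k ∈ Finset.range T, (a * ε) ^ 2 / (T : ℝ) ^ (2 * θ) := by simp
      _ ≤ _ := by
        refine Finset.sum_le_sum fun k hk => ?_
        have hk' : (k : ℝ) + 1 ≤ T := by exact_mod_cast Finset.mem_range.1 hk
        calc (a * ε) ^ 2 / (T : ℝ) ^ (2 * θ) ≤ (a * ε) ^ 2 / ((k : ℝ) + 1) ^ (2 * θ) := by
              gcongr
          _ = (a * errEnvelope ε θ k) ^ 2 := by
              rw [mul_pow, mul_pow, errEnvelope_sq, mul_div_assoc]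
          _ ≤ e k ^ 2 := by
              have := errEnvelope_pos hε θ k
              gcongr
              exact he k
  have h1 : 0 ≤ 16 * L * Δ / (κ * T) := by positivity
  calc 3 * MΦ ^ 2 * (a * ε) ^ 2 / (T : ℝ) ^ (2 * θ)
      = 3 * MΦ ^ 2 / T * (T * ((a * ε) ^ 2 / (T : ℝ) ^ (2 * θ))) := by field_simp
    _ ≤ 3 * MΦ ^ 2 / T * ∑ k ∈ Finset.range T, e k ^ 2 := by gcongr
    _ ≤ _ := by
      unfold mbBound
      linarith

/-- The quotient of the orders `T^{-2/3}` and `T^{-2θ}` of the two bounds. -/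
theorem mul_le_mbBound {κ L MΦ Δ ε θ a K : ℝ} (hκ : 0 < κ) (hL : 0 < L) (hΦ : 0 < MΦ) (hΔ : 0 ≤ Δ)
    (hε : 0 < ε) (hθ : 0 ≤ θ) (ha : 0 < a) (hK : 0 < K) {e : ℕ → ℝ}
    (he : ∀ k, a * errEnvelope ε θ k ≤ e k) (p : ℕ) {T : ℕ} (hT : 1 ≤ T) :
    K * ((p : ℝ) ^ 2 / (T : ℝ) ^ (2 / 3 : ℝ))
      ≤ K / (3 * MΦ ^ 2 * (a * ε) ^ 2) * ((p : ℝ) ^ 2 / (T : ℝ) ^ (2 / 3 - 2 * θ))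
        * mbBound κ L MΦ Δ e T := by
  have hT0 : (0 : ℝ) < T := by exact_mod_cast hT
  calc K * ((p : ℝ) ^ 2 / (T : ℝ) ^ (2 / 3 : ℝ))
      = K * ((p : ℝ) ^ 2 / ((T : ℝ) ^ (2 / 3 - 2 * θ) * (T : ℝ) ^ (2 * θ))) := by
        rw [← Real.rpow_add hT0, sub_add_cancel]
    _ = K / (3 * MΦ ^ 2 * (a * ε) ^ 2) * ((p : ℝ) ^ 2 / (T : ℝ) ^ (2 / 3 - 2 * θ))
        * (3 * MΦ ^ 2 * (a * ε) ^ 2 / (T : ℝ) ^ (2 * θ)) := by field_simp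
    _ ≤ _ := by
        gcongr
        exact le_mbBound hκ hL hΔ hε hθ ha he hT

theorem tendsto_div_mbBound {κ L MΦ Δ ε θ a K : ℝ} (hκ : 0 < κ) (hL : 0 < L) (hΦ : 0 < MΦ)
    (hΔ : 0 ≤ Δ) (hε : 0 < ε) (hθ : 0 ≤ θ) (hθ3 : θ < 1 / 3) (ha : 0 < a) (hK : 0 < K) {e : ℕ → ℝ}
    (he : ∀ k, a * errEnvelope ε θ k ≤ e k) (p : ℕ) :
    Filter.Tendsto (fun T : ℕ =>
      K * ((p : ℝ) ^ 2 / (T : ℝ) ^ (2 / 3 : ℝ)) / mbBound κ L MΦ Δ e T) Filter.atTop (nhds 0) := by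
  have hlim : Filter.Tendsto (fun T : ℕ => K / (3 * MΦ ^ 2 * (a * ε) ^ 2)
      * ((p : ℝ) ^ 2 / (T : ℝ) ^ (2 / 3 - 2 * θ))) Filter.atTop (nhds 0) := by
    have h := (((tendsto_rpow_atTop (by linarith : 0 < 2 / 3 - 2 * θ)).comp
      tendsto_natCast_atTop_atTop).const_div_atTop ((p : ℝ) ^ 2)).const_mul
        (K / (3 * MΦ ^ 2 * (a * ε) ^ 2))
    rwa [mul_zero] at h
  refine squeeze_zero' ?_ ?_ hlim
  all_goals
    filter_upwards [Filter.eventually_ge_atTop 1] with T hT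
    have hT0 : (0 : ℝ) < T := by exact_mod_cast hT
    have hmb : 0 < mbBound κ L MΦ Δ e T :=
      lt_of_lt_of_le (by positivity) (le_mbBound hκ hL hΔ hε hθ ha he hT)
  · positivity
  · rw [div_le_iff₀ hmb]
    exact mul_le_mbBound hκ hL hΦ hΔ hε hθ ha hK he p hT

/-! ### The comparison of the two controllers -/

theorem corollary1 :
    ∃ Cst : ℝ → ℝ → ℝ, (∀ M s : ℝ, 0 < M → 0 ≤ s → 0 < Cst M s) ∧
    -- the model-based bound is valid for the model-based closed loop
    (∀ (L M MΦ κ : ℝ), 0 < L → 0 < M → 0 < MΦ → 0 < κ → κ ≤ 1 →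
      ∀ (p q r T : ℕ), 1 ≤ p → 1 ≤ T →
      ∀ (P : SteadyProblem p q r) (w₀ : Euc p), P.Regular L M MΦ →
      ∀ (Hhat : ℕ → Euc p →L[ℝ] Euc q) (e : ℕ → ℝ),
        (∀ k < T, ‖Hhat k - P.sens (P.modelCand Hhat (mbStep κ L) w₀ k)‖ ≤ e k) →
        1 / (T : ℝ) * ∑ k ∈ Finset.range T,
            ‖gradient P.obj (P.modelCand Hhat (mbStep κ L) w₀ k)‖ ^ 2
          ≤ mbBound κ L MΦ (P.obj w₀ - P.objInf) e T) ∧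
    -- the gray-box bound is valid for the gray-box closed loop
    (∀ (L M MΦ κ : ℝ), 0 < L → 0 < M → 0 < MΦ → 0 < κ → κ ≤ 1 →
      ∀ (p q r T : ℕ), 1 ≤ p → 1 ≤ T →
      ∀ (P : SteadyProblem p q r) (w₀ uInit : Euc p), P.Regular L M MΦ →
      ∀ (α e : ℕ → ℝ), (∀ k, 0 ≤ α k ∧ α k ≤ 1) →
      ∀ {Ω : Type*} {mΩ : MeasurableSpace Ω} (μ : Measure Ω) [IsProbabilityMeasure μ]
        (ℱ : Filtration ℕ mΩ) (v : ℕ → Ω → Euc p) (Hhat : ℕ → Ω → Euc p →L[ℝ] Euc q),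
        IsGrayBoxLoop P w₀ uInit T (gbStep κ L p T) (gbSmoothing L M T) α e μ ℱ v Hhat →
        (∀ k < T, Integrable (fun ω => ‖gradient P.obj
          (P.cand (fun j => Hhat j ω) α (gbStep κ L p T) (gbSmoothing L M T)
            (fun j => v j ω) w₀ uInit k)‖ ^ 2) μ) ∧
        1 / (T : ℝ) * ∑ k ∈ Finset.range T, ∫ ω, ‖gradient P.obj
          (P.cand (fun j => Hhat j ω) α (gbStep κ L p T) (gbSmoothing L M T)
            (fun j => v j ω) w₀ uInit k)‖ ^ 2 ∂μ
          ≤ gbBound κ L M MΦ (P.obj w₀ - P.objInf)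
              (Cst M (∫ ω, ‖P.direction (Hhat 0 ω) (α 0) (gbSmoothing L M T) (v 0 ω)
                (w₀ + gbSmoothing L M T • v 0 ω) uInit‖ ^ 2 ∂μ)) α e p T) ∧
    -- errors decaying at a rate `θ ≥ 1/3`: the model-based bound is preferable
    (∀ (L M MΦ Δ ε θ κ κ' : ℝ), 0 < L → 0 < M → 0 < MΦ → 0 ≤ Δ → 0 < ε → 1 / 3 ≤ θ →
      0 < κ → κ ≤ 1 → 0 < κ' → κ' ≤ 1 →
      ∃ K K' : ℝ, 0 < K ∧ 0 < K' ∧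
        ∀ (T : ℕ) (e : ℕ → ℝ), 1 ≤ T → (∀ k < T, 0 ≤ e k ∧ e k ≤ errEnvelope ε θ k) →
          mbBound κ L MΦ Δ e T ≤ K / (T : ℝ) ^ (2 / 3 : ℝ) ∧
          ∀ (p : ℕ) (α : ℕ → ℝ) (c : ℝ), 1 ≤ p → (∀ k, 0 ≤ α k ∧ α k ≤ 1) → 0 ≤ c →
            K / (T : ℝ) ^ (2 / 3 : ℝ) ≤ K' * gbBound κ' L M MΦ Δ c α e p T ∧
            (0 < Δ → K / (T : ℝ) ^ (2 / 3 : ℝ)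
              ≤ K' / (p : ℝ) ^ 2 * gbBound κ' L M MΦ Δ c α e p T) ∧
            (0 < Δ → K' < (p : ℝ) ^ 2 →
              K / (T : ℝ) ^ (2 / 3 : ℝ) < gbBound κ' L M MΦ Δ c α e p T)) ∧
    -- bounded errors (`θ = 0`) or errors decaying at a rate `0 < θ < 1/3`:
    -- the gray-box bound is smaller
    (∀ (L M MΦ Δ ε θ C R κ κ' : ℝ), 0 < L → 0 < M → 0 < MΦ → 0 ≤ Δ → 0 < ε →
      0 ≤ θ → θ < 1 / 3 → 0 < C → 0 ≤ R → 0 < κ → κ ≤ 1 → 0 < κ' → κ' ≤ 1 →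
      ∃ K : ℝ, 0 < K ∧
        (∀ (p q r T : ℕ), 1 ≤ p → 1 ≤ T →
          ∀ (P : SteadyProblem p q r) (w₀ uInit : Euc p), P.Regular L M MΦ →
          P.obj w₀ - P.objInf = Δ → ‖w₀ - uInit‖ ≤ R →
          ∀ {Ω : Type*} {mΩ : MeasurableSpace Ω} (μ : Measure Ω) [IsProbabilityMeasure μ]
            (ℱ : Filtration ℕ mΩ) (v : ℕ → Ω → Euc p) (Hhat : ℕ → Ω → Euc p →L[ℝ] Euc q),
            IsGrayBoxLoop P w₀ uInit T (gbStep κ' L p T) (gbSmoothing L M T) (combCoeff C θ)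
              (errEnvelope ε θ) μ ℱ v Hhat →
            1 / (T : ℝ) * ∑ k ∈ Finset.range T, ∫ ω, ‖gradient P.obj
              (P.cand (fun j => Hhat j ω) (combCoeff C θ) (gbStep κ' L p T) (gbSmoothing L M T)
                (fun j => v j ω) w₀ uInit k)‖ ^ 2 ∂μ
              ≤ K * ((p : ℝ) ^ 2 / (T : ℝ) ^ (2 / 3 : ℝ))) ∧
        -- the worst case of the model-based bound over the admitted errors is at the envelope
        (∀ T : ℕ, 1 ≤ T → IsGreatest
          {b : ℝ | ∃ e : ℕ → ℝ, (∀ k < T, 0 ≤ e k ∧ e k ≤ errEnvelope ε θ k) ∧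
            b = mbBound κ L MΦ Δ e T}
          (mbBound κ L MΦ Δ (errEnvelope ε θ) T)) ∧
        -- the comparison, at the envelope (`a = 1`) and at all errors of the same order
        (∀ a : ℝ, 0 < a → a ≤ 1 → ∃ K' : ℝ, 0 < K' ∧
          ∀ e : ℕ → ℝ, (∀ k, a * errEnvelope ε θ k ≤ e k) →
            (∀ (p T : ℕ), 1 ≤ p → 1 ≤ T →
              K * ((p : ℝ) ^ 2 / (T : ℝ) ^ (2 / 3 : ℝ))
                ≤ K' * ((p : ℝ) ^ 2 / (T : ℝ) ^ (2 / 3 - 2 * θ)) * mbBound κ L MΦ Δ e T) ∧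
            ∀ p : ℕ, 1 ≤ p →
              (∀ᶠ T : ℕ in Filter.atTop,
                K * ((p : ℝ) ^ 2 / (T : ℝ) ^ (2 / 3 : ℝ)) < mbBound κ L MΦ Δ e T) ∧
              Filter.Tendsto (fun T : ℕ =>
                K * ((p : ℝ) ^ 2 / (T : ℝ) ^ (2 / 3 : ℝ)) / mbBound κ L MΦ Δ e T)
                Filter.atTop (nhds 0))) := by
  refine ⟨fun M s => M ^ 2 + s, fun M s hM hs => by positivity, ?_, ?_, ?_, ?_⟩
  · intro L M MΦ κ hL _ hΦ hκ hκ1 p q r T _ hT P w₀ hP Hhat e he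
    exact modelBased_average_le hP hT hL hΦ hκ hκ1 w₀ Hhat e he
  · intro L M MΦ κ hL hM hΦ hκ hκ1 p q r T hp hT P w₀ uInit hP α e hα Ω mΩ μ _ ℱ v Hhat h
    refine ⟨fun k _ => h.integrable_norm_gradient_sq hP hL.le hM.le k,
      (h.average_le hP hp hT hL hM hΦ hκ hκ1 hα).trans (gbBound_mono_const ?_ α e p T)⟩
    have hs : 0 ≤ ∫ ω, ‖h.dir 0 ω‖ ^ 2 ∂μ := integral_nonneg fun ω => sq_nonneg _
    have hpx : 1 ≤ (p : ℝ) ^ 2 * (T : ℝ) ^ (1 / 3 : ℝ) :=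
      one_le_mul_of_one_le_of_one_le (one_le_pow₀ (by exact_mod_cast hp)) (one_le_rpow_third hT)
    exact add_le_add le_rfl (div_le_self hs hpx)
  · intro L M MΦ Δ ε θ κ κ' hL hM hΦ hΔ hε hθ hκ _ hκ' _
    set K := 16 * L * Δ / κ + 9 * MΦ ^ 2 * ε ^ 2
    have hK : 0 < K := by positivity
    -- for `Δ = 0` the last summand is `0`
    refine ⟨K, K * 112 ^ 2 / M ^ 2 + K * κ' / (896 * L * Δ), hK, by positivity, ?_⟩
    intro T e hT he
    refine ⟨mbBound_le_of_fast_decay hκ hL hΔ hθ hT he, ?_⟩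
    intro p α c hp hα hc
    set K' := K * 112 ^ 2 / M ^ 2 + K * κ' / (896 * L * Δ) with hK'
    have hK'0 : 0 < K' := by positivity
    have hp0 : (0 : ℝ) < p := by exact_mod_cast hp
    have hT0 : (0 : ℝ) < T := by exact_mod_cast hT
    have hgb := le_gbBound (κ := κ') (L := L) (M := M) (MΦ := MΦ) (Δ := Δ) (e := e) hp hT hα hc
    have hgb0 : 0 < gbBound κ' L M MΦ Δ c α e p T := lt_of_lt_of_le (by positivity) hgb
    have hsecond : 0 < Δ → K / (T : ℝ) ^ (2 / 3 : ℝ)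
        ≤ K' / (p : ℝ) ^ 2 * gbBound κ' L M MΦ Δ c α e p T := by
      intro hΔ0
      calc K / (T : ℝ) ^ (2 / 3 : ℝ) = K * κ' / (896 * L * Δ) / (p : ℝ) ^ 2
            * (896 * L * Δ / κ' * (p : ℝ) ^ 2 / (T : ℝ) ^ (2 / 3 : ℝ)) := by field_simp
        _ ≤ K' / (p : ℝ) ^ 2 * ((896 * L * Δ / κ' * (p : ℝ) ^ 2 + M ^ 2 / 112 ^ 2)
            / (T : ℝ) ^ (2 / 3 : ℝ)) := by
          gcongr
          · exact le_add_of_nonneg_left (by positivity)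
          · exact le_add_of_nonneg_right (by positivity)
        _ ≤ _ := by gcongr
    refine ⟨?_, hsecond, fun hΔ0 hp2 => (hsecond hΔ0).trans_lt ?_⟩
    · calc K / (T : ℝ) ^ (2 / 3 : ℝ)
          = K * 112 ^ 2 / M ^ 2 * (M ^ 2 / 112 ^ 2 / (T : ℝ) ^ (2 / 3 : ℝ)) := by field_simp
        _ ≤ K' * ((896 * L * Δ / κ' * (p : ℝ) ^ 2 + M ^ 2 / 112 ^ 2)
            / (T : ℝ) ^ (2 / 3 : ℝ)) := by
          gcongr
          · exact le_add_of_nonneg_right (by positivity)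
          · exact le_add_of_nonneg_left (by positivity)
        _ ≤ _ := by gcongr
    · exact mul_lt_of_lt_one_left hgb0 ((div_lt_one (by positivity)).2 hp2)
  · intro L M MΦ Δ ε θ C R κ κ' hL hM hΦ hΔ hε hθ hθ3 hC hR hκ _ hκ' hκ'1
    set Kc := 3 * M ^ 2 + (M + MΦ * ε) ^ 2 + (112 * L * R) ^ 2 with hKc
    have hKc0 : 0 ≤ Kc := by positivity
    set K := 896 * L * Δ / κ' + 15 * MΦ ^ 2 * C * ε ^ 2 + 8 * M ^ 2 / 112 ^ 2 + Kc
    have hK : 0 < K := by positivity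
    refine ⟨K, hK, ?_, ?_, ?_⟩
    · intro p q r T hp hT P w₀ uInit hP hPΔ hwR Ω mΩ μ _ ℱ v Hhat h
      have h1 := h.average_le hP hp hT hL hM hΦ hκ' hκ'1 (combCoeff_mem hC θ)
      have h2 := h.initial_le hP hp hT hL hM hΦ (combCoeff_mem hC θ) hwR
      have he0 : errEnvelope ε θ 0 = ε := by simp [errEnvelope]
      rw [he0, ← hKc] at h2
      rw [hPΔ] at h1
      exact h1.trans (gbBound_le_of_slow_decay hC hp hT hKc0 h2)
    · intro T _
      refine ⟨⟨errEnvelope ε θ, fun k _ => ⟨(errEnvelope_pos hε θ k).le, le_rfl⟩, rfl⟩, ?_⟩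
      rintro b ⟨e, he, rfl⟩
      exact mbBound_le_mbBound κ L MΦ Δ he
    · intro a ha _
      refine ⟨K / (3 * MΦ ^ 2 * (a * ε) ^ 2), by positivity, fun e he => ⟨?_, fun p _ => ?_⟩⟩
      · exact fun p T _ hT => mul_le_mbBound hκ hL hΦ hΔ hε hθ ha hK he p hT
      · have hlim := tendsto_div_mbBound hκ hL hΦ hΔ hε hθ hθ3 ha hK he p
        refine ⟨?_, hlim⟩
        filter_upwards [hlim.eventually_lt_const zero_lt_one, Filter.eventually_ge_atTop 1]
          with T h1 hT
        have hT0 : (0 : ℝ) < T := by exact_mod_cast hT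
        have hmb : 0 < mbBound κ L MΦ Δ e T :=
          lt_of_lt_of_le (by positivity) (le_mbBound hκ hL hΔ hε hθ ha he hT)
        exact (div_lt_one hmb).1 h1
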